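/- All groups are finite and all representations and characters are over $\mathbb{C}$ and of positive degree. For $N\le J$ and $\theta\in\mathrm{Irr}(N)$, $\mathrm{Irr}(J\mid\theta)$ is the set of irreducible constituents of $\mathrm{Ind}_N^J\theta$, and $\mathrm{Char}(J\mid\theta)$ is the set of characters of $J$ all of whose irreducible constituents lie in $\mathrm{Irr}(J\mid\theta)$. Characters and projective representations of $J/N$ are identified with their inflations to $J$. A character triple $(G,N,\theta)$ consists of a finite group $G$, $N\trianglelefteq G$ and a $G$-invariant $\theta\in\mathrm{Irr}(N)$. A projective representation of $G$ is a map $\mathcal P\colon G\to\mathrm{GL}_n(\mathbb C)$ with $\mathcal P(g)\mathcal P(h)=\alpha(g,h)\mathcal P(gh)$ for some $\alpha\colon G\times G\to\mathbb C^\times$, the factor set of $\mathcal P$. It is associated with $(G,N,\theta)$ if $\mathcal P|_N$ is a linear representation affording $\theta$, and $\mathcal P(ng)=\mathcal P(n)\mathcal P(g)$ and $\mathcal P(gn)=\mathcal P(g)\mathcal P(n)$ for all $n\in N$, $g\in G$. For character triples $(G,N,\theta)$ and $(H,M,\varphi)$ we say that $(G,N,\theta)\geqslant_{(g)}(H,M,\varphi)$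 is given by $(\mathcal P,\mathcal P')$ if $H\le G$, $N\cap H=M$, and $\mathcal P$, $\mathcal P'$ are projective representations associated with $(G,N,\theta)$ and $(H,M,\varphi)$ whose factor sets $\alpha$, $\alpha'$ satisfy $\alpha|_{H\times H}=\alpha'$. An isomorphism of character triples $(\tau,\sigma)\colon(G,N,\theta)\to(\Gamma,M,\varphi)$ consists of a group isomorphism $\tau\colon G/N\to\Gamma/M$ and, for every $N\le J\le G$ with $J^\tau\le \Gamma$ the inverse image of $\tau(J/N)$, a map $\sigma_J\colon\mathrm{Char}(J\mid\theta)\to\mathrm{Char}(J^\tau\mid\varphi)$ such that, for $N\le K\le J\le G$ and $\chi,\psi\in\mathrm{Char}(J\mid\theta)$: $\sigma_J(\chi+\psi)=\sigma_J(\chi)+\sigma_J(\psi)$; $[\chi,\psi]=[\sigma_J(\chi),\sigma_J(\psi)]$; $\sigma_K(\mathrm{Res}^J_K\chi)=\mathrm{Res}^{J^\tau}_{K^\tau}\sigma_J(\chi)$; and $\sigma_J(\chi\beta)=\sigma_J(\chi)\beta^\tau$ for every character $\beta$ of $J/N$, where $\beta^\tau$ is the character of $J^\tau/M$ corresponding to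 $\beta$ under $\tau$. It is strong if moreover $\sigma_J(\chi)^{\gamma}=\sigma_{J^g}(\chi^g)$ whenever $g\in G$, $\gamma\in\Gamma$ and $\tau(gN)=\gamma M$. Here $J^g=g^{-1}Jg$ and $\chi^g(x)=\chi(gxg^{-1})$. **Theorem.** Suppose that $(G,N,\theta)\geqslant_{(g)}(H,M,\varphi)$ is given by $(\mathcal P,\mathcal P')$. Then for every $N\le J\le G$ there is a well-defined map, which is the restriction of a $\mathbb C$-linear map on functions, $$\sigma_J\colon\mathrm{Char}(J\mid\theta)\to\mathrm{Char}(J\cap H\mid\varphi),\qquad \mathrm{tr}(\mathcal Q\otimes\mathcal P|_J)\mapsto\mathrm{tr}(\mathcal Q|_{J\cap H}\otimes\mathcal P'|_{J\cap H}),$$ for any projective representation $\mathcal Q$ of $J/N$ whose factor set is inverse to that of $\mathcal P|_J$. (In particular $\mathrm{Char}(J\mid\theta)$ is exactly the set of all $\mathrm{tr}(\mathcal Q\otimes\mathcal P|_J)$ for such $\mathcal Q$.) For all $N\le K\le J\le G$ and $\chi\in\mathrm{Char}(J\mid\theta)$: (a) $\mathrm{Res}^{J\cap H}_{K\cap H}(\sigma_J(\chi))=\sigma_K(\mathrm{Res}^J_K\chi)$;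 (b) $\sigma_J(\chi\beta)=\sigma_J(\chi)\,\mathrm{Res}^J_{J\cap H}(\beta)$ for every $\beta\in\mathrm{Char}(J/N)$; (c) $\sigma_J(\chi)^h=\sigma_{J^h}(\chi^h)$ for every $h\in H$; (d) if $J=N(J\cap H)$, then $\sigma_J$ is a bijection $\mathrm{Char}(J\mid\theta)\to\mathrm{Char}(J\cap H\mid\varphi)$. In particular, the maps $\sigma_J$ with $N\le J\le NH$, together with the canonical isomorphism $NH/N\to H/M$, form a strong isomorphism of character triples $(NH,N,\theta)\to(H,M,\varphi)$; (e) if $J/N$ is abelian and $\theta$ extends to $J$, then $\sigma_J$ restricts to a surjection $\mathrm{Irr}(J\mid\theta)\to\mathrm{Irr}(J\cap H\mid\varphi)$. -/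

import Mathlib

noncomputable section

namespace CharTriples

/-! ### Ordinary characters of finite groups (complex valued functions) -/

section Characters

variable {G : Type*} [Group G]

/-- `Char(G)`: the functions afforded by complex representations of positive degree. -/
def charSet (G : Type*) [Group G] : Set (G → ℂ) :=
  {χ | ∃ (n : ℕ) (ρ : Representation ℂ G (Fin n → ℂ)), 0 < n ∧ χ = ρ.character}

/-- `Irr(G)`: the functions afforded by irreducible complex representations. -/
def irr (G : Type*) [Group G] : Set (G → ℂ) :=
  {χ | ∃ (n : ℕ) (ρ : Representation ℂ G (Fin n → ℂ)), ρ.IsIrreducible ∧ χ = ρ.character}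

/-- The usual inner product `[χ, ψ] = |G|⁻¹ ∑ χ(g) conj (ψ(g))` (for finite `G`). -/
def innerProd (χ ψ : G → ℂ) : ℂ :=
  (Nat.card G : ℂ)⁻¹ * ∑ᶠ g : G, χ g * star (ψ g)

/-- `ψ` is an irreducible constituent of the character `χ`. -/
def IsConstituent (ψ χ : G → ℂ) : Prop := ψ ∈ irr G ∧ innerProd χ ψ ≠ 0

end Characters

section Subgroups

variable {A : Type*} [Group A]

/-- Restriction of functions from `J` to `K ≤ J`. -/
def res {K J : Subgroup A} (h : K ≤ J) (χ : J → ℂ) : K → ℂ :=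
  fun x => χ (Subgroup.inclusion h x)

open Classical in
/-- The induced character `Ind_N^J(θ)(g) = |N|⁻¹ ∑_{x ∈ J, x g x⁻¹ ∈ N} θ(x g x⁻¹)`. -/
def ind {N : Subgroup A} (J : Subgroup A) (θ : N → ℂ) : J → ℂ :=
  fun g => (Nat.card N : ℂ)⁻¹ *
    ∑ᶠ x : J, if h : (x : A) * g * (x : A)⁻¹ ∈ N then θ ⟨(x : A) * g * (x : A)⁻¹, h⟩ else 0

/-- `Irr(J ∣ θ)`: the irreducible constituents of `Ind_N^J(θ)` (to be used for `N ≤ J`). -/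
def irrOver {N : Subgroup A} (J : Subgroup A) (θ : N → ℂ) : Set (J → ℂ) :=
  {χ | IsConstituent χ (ind J θ)}

/-- `Char(J ∣ θ)`: the characters of `J` all of whose irreducible constituents lie in
`Irr(J ∣ θ)`. -/
def charOver {N : Subgroup A} (J : Subgroup A) (θ : N → ℂ) : Set (J → ℂ) :=
  {χ | χ ∈ charSet J ∧ ∀ ψ, IsConstituent ψ χ → ψ ∈ irrOver J θ}

/-- `Char(J / N)`: the characters of `J` afforded by representations with `N` in the kernel. -/
def charQuot (N J : Subgroup A) : Set (J → ℂ) :=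
  {β | ∃ (n : ℕ) (ρ : Representation ℂ J (Fin n → ℂ)), 0 < n ∧
    (∀ x : J, (x : A) ∈ N → ρ x = 1) ∧ β = ρ.character}

/-- The conjugate subgroup `J ^ a = a⁻¹ J a`. -/
def conjSub (a : A) (J : Subgroup A) : Subgroup A :=
  J.comap (MulAut.conj a).toMonoidHom

/-- The conjugate `χ ^ a : x ↦ χ (a x a⁻¹)` of a function `χ` on `J`, as a function on a subgroup
`L ≤ J ^ a` (normally `L = J ^ a`, possibly written in a different way). -/
def conjChar (a : A) {J L : Subgroup A} (h : L ≤ conjSub a J) (χ : J → ℂ) : L → ℂ :=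
  fun x => χ ⟨a * x * a⁻¹, h x.2⟩

end Subgroups

/-! ### Character triples -/

/-- A character triple `(G, N, θ)`, with `G` a subgroup of some ambient group:
`N ⊴ G`, and `θ ∈ Irr(N)` is `G`-invariant. -/
structure CharTriple (A : Type*) [Group A] where
  G : Subgroup A
  N : Subgroup A
  N_le : N ≤ G
  conj_mem : ∀ g ∈ G, ∀ x ∈ N, g * x * g⁻¹ ∈ N
  θ : N → ℂ
  θ_irr : θ ∈ irr N
  θ_inv : ∀ (g : A) (hg : g ∈ G) (x : N), θ ⟨g * x * g⁻¹, conj_mem g hg x x.2⟩ = θ x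

namespace CharTriple

variable {A : Type*} [Group A]

instance (T : CharTriple A) : (T.N.subgroupOf T.G).Normal :=
  ⟨fun x hx g => T.conj_mem g g.2 x hx⟩

/-- The quotient group `G / N`. -/
abbrev Quot (T : CharTriple A) : Type _ := T.G ⧸ T.N.subgroupOf T.G

/-- The canonical map `G → G / N`. -/
def proj (T : CharTriple A) : T.G →* T.Quot := QuotientGroup.mk' _

/-- The character triple `(J, N, θ)` for `N ≤ J ≤ G`. -/
def restrict (T : CharTriple A) (J : Subgroup A) (hNJ : T.N ≤ J) (hJG : J ≤ T.G) :
    CharTriple A where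
  G := J
  N := T.N
  N_le := hNJ
  conj_mem g hg := T.conj_mem g (hJG hg)
  θ := T.θ
  θ_irr := T.θ_irr
  θ_inv g hg := T.θ_inv g (hJG hg)

/-- Strong isomorphisms of character triples `(G, N, θ) → (Γ, M, φ)`. Here
`τ : G / N ≃* Γ / M`, `F J` is the inverse image in `Γ` of `τ (J / N)`
(called `J ^ τ` in the comments), and `σ J : Char(J ∣ θ) → Char(J ^ τ ∣ φ)`; the values of `F J`
and `σ J` only matter for `N ≤ J ≤ G`, and those of `σ J` only on `Char(J ∣ θ)`. -/
structure IsStrongIso {B : Type*} [Group B] (T : CharTriple A) (S : CharTriple B)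
    (τ : T.Quot ≃* S.Quot) (F : Subgroup A → Subgroup B)
    (σ : ∀ J : Subgroup A, (J → ℂ) → (F J → ℂ)) : Prop where
  le_G : ∀ J, T.N ≤ J → J ≤ T.G → F J ≤ S.G
  mem_iff : ∀ J, T.N ≤ J → J ≤ T.G →
    ∀ y : S.G, (y : B) ∈ F J ↔ ∃ x : T.G, (x : A) ∈ J ∧ τ (T.proj x) = S.proj y
  mapsTo : ∀ J, T.N ≤ J → J ≤ T.G →
    Set.MapsTo (σ J) (charOver J T.θ) (charOver (F J) S.θ)
  -- additivity
  add : ∀ J, T.N ≤ J → J ≤ T.G → ∀ χ ∈ charOver J T.θ, ∀ ψ ∈ charOver J T.θ,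
    χ + ψ ∈ charOver J T.θ ∧ σ J (χ + ψ) = σ J χ + σ J ψ
  -- isometry
  isometry : ∀ J, T.N ≤ J → J ≤ T.G → ∀ χ ∈ charOver J T.θ, ∀ ψ ∈ charOver J T.θ,
    innerProd χ ψ = innerProd (σ J χ) (σ J ψ)
  -- compatibility with restriction
  restriction : ∀ (K J : Subgroup A) (hKJ : K ≤ J), T.N ≤ K → J ≤ T.G →
    ∃ hF : F K ≤ F J, ∀ χ ∈ charOver J T.θ,
      res hKJ χ ∈ charOver K T.θ ∧ σ K (res hKJ χ) = res hF (σ J χ)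
  -- `σ_J(χ β) = σ_J(χ) β ^ τ`, where `β ^ τ (y) = β(x)` if `τ(x N) = y M`
  mul : ∀ J, T.N ≤ J → J ≤ T.G → ∀ χ ∈ charOver J T.θ, ∀ β ∈ charQuot T.N J,
    χ * β ∈ charOver J T.θ ∧
    ∀ (x : T.G) (y : S.G) (hx : (x : A) ∈ J) (hy : (y : B) ∈ F J), τ (T.proj x) = S.proj y →
      σ J (χ * β) ⟨y, hy⟩ = σ J χ ⟨y, hy⟩ * β ⟨x, hx⟩
  -- compatibility with conjugation: `σ_{J^g}(χ^g) = σ_J(χ)^γ` if `τ(g N) = γ M`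
  conj : ∀ J, T.N ≤ J → J ≤ T.G → ∀ (g : T.G) (γ : S.G), τ (T.proj g) = S.proj γ →
    T.N ≤ conjSub (g : A) J ∧ conjSub (g : A) J ≤ T.G ∧
    ∃ hF : F (conjSub (g : A) J) ≤ conjSub (γ : B) (F J), ∀ χ ∈ charOver J T.θ,
      conjChar (g : A) le_rfl χ ∈ charOver (conjSub (g : A) J) T.θ ∧
      σ (conjSub (g : A) J) (conjChar (g : A) le_rfl χ) = conjChar (γ : B) hF (σ J χ)

end CharTriple

/-! ### Projective representations -/

/-- A projective `ℂ`-representation of `G` of degree `n ≥ 1`, together with its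
(uniquely determined) factor set. -/
structure ProjRep (G : Type*) [Group G] (n : ℕ) where
  toFun : G → Matrix.GeneralLinearGroup (Fin n) ℂ
  factorSet : G → G → ℂˣ
  pos : 0 < n
  mul_eq : ∀ g h, (toFun g : Matrix (Fin n) (Fin n) ℂ) * (toFun h : Matrix (Fin n) (Fin n) ℂ) =
    (factorSet g h : ℂ) • (toFun (g * h) : Matrix (Fin n) (Fin n) ℂ)

namespace ProjRep

variable {A : Type*} [Group A] {n m : ℕ}

/-- Restriction to a subgroup. -/
def res {K J : Subgroup A} (h : K ≤ J) (P : ProjRep J n) : ProjRep K n where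
  toFun x := P.toFun (Subgroup.inclusion h x)
  factorSet x y := P.factorSet (Subgroup.inclusion h x) (Subgroup.inclusion h y)
  pos := P.pos
  mul_eq x y := by simpa using P.mul_eq (Subgroup.inclusion h x) (Subgroup.inclusion h y)

/-- `Q` is (the inflation to `J` of) a projective representation of `J / N`,
i.e. `Q` is constant on the cosets of `N`. -/
def IsInflated {J : Subgroup A} (Q : ProjRep J m) (N : Subgroup A) : Prop :=
  ∀ x y : J, (x : A)⁻¹ * y ∈ N → Q.toFun x = Q.toFun y

/-- The factor set of `Q` is inverse to the one of `P`. -/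
def HasInverseFactorSet {G : Type*} [Group G] (Q : ProjRep G m) (P : ProjRep G n) : Prop :=
  ∀ x y, Q.factorSet x y = (P.factorSet x y)⁻¹

/-- The function `x ↦ trace (Q(x) ⊗ P(x))`. -/
def tensorTrace {G : Type*} [Group G] (Q : ProjRep G m) (P : ProjRep G n) : G → ℂ :=
  fun x => Matrix.trace (Matrix.kronecker (Q.toFun x : Matrix (Fin m) (Fin m) ℂ)
    (P.toFun x : Matrix (Fin n) (Fin n) ℂ))

/-- `P` is associated with the character triple `(G, N, θ)`: the restriction of `P` to `N` is a
linear representation affording `θ`, and `P(x g) = P(x) P(g)`, `P(g x) = P(g) P(x)` for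
`x ∈ N`, `g ∈ G`. (In particular the degree of `P` is `θ(1)`.) -/
structure IsAssociated (T : CharTriple A) (P : ProjRep T.G n) : Prop where
  map_mul : ∀ x y : T.N, P.toFun (Subgroup.inclusion T.N_le (x * y)) =
    P.toFun (Subgroup.inclusion T.N_le x) * P.toFun (Subgroup.inclusion T.N_le y)
  affords : ∀ x : T.N, Matrix.trace (P.toFun (Subgroup.inclusion T.N_le x) :
    Matrix (Fin n) (Fin n) ℂ) = T.θ x
  map_mul_left : ∀ (x : T.N) (g : T.G), P.toFun (Subgroup.inclusion T.N_le x * g) =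
    P.toFun (Subgroup.inclusion T.N_le x) * P.toFun g
  map_mul_right : ∀ (x : T.N) (g : T.G), P.toFun (g * Subgroup.inclusion T.N_le x) =
    P.toFun g * P.toFun (Subgroup.inclusion T.N_le x)

end ProjRep

/-- `(G, N, θ) ≥_{(g)} (H, M, φ)` is given by the projective representations `(P, P')`. -/
structure GivesRel {A : Type*} [Group A] {n n' : ℕ} (T S : CharTriple A)
    (P : ProjRep T.G n) (P' : ProjRep S.G n') : Prop where
  le : S.G ≤ T.G
  inf_eq : T.N ⊓ S.G = S.N
  assoc : P.IsAssociated T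
  assoc' : P'.IsAssociated S
  factorSet_eq : ∀ x y : S.G,
    P.factorSet (Subgroup.inclusion le x) (Subgroup.inclusion le y) = P'.factorSet x y

end CharTriples

end

open CharTriples

/-! Write α for the factor set of P. Schur orthogonality for θ gives, on every coset gN, the duality
∑ tr P(gx) · tr (P(gx)⁻¹) = |N|, the sum over x ∈ N. If χ = tr(Q ⊗ P) with Q inflated from J/N, then
tr Q is constant on gN, so averaging χ · tr(P⁻¹) over gN returns tr Q(g). Hence σ_J can be defined
on all functions by an explicit linear formula: this average (`ProjRep.cofactor`) times tr P'
(`charMap`). Independence of the choice of Q is then automatic, and compatibility with restriction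
and with characters of J/N can be read off the formula.

That every χ over θ has the form tr(Q ⊗ P) is `exists_eq_tensorTrace`. If r affords χ, then Φ(X) =
(n/|N|) ∑ tr(P(x⁻¹)X) r(x) is multiplicative on n × n matrices, and Φ(1) = 1 because all
constituents of χ lie over θ. The matrices r(g)Φ(P(g)⁻¹) commute with the image of Φ and form a
projective representation with factor set α⁻¹. Compressing it to the range of Φ(E), for a diagonal
matrix unit E, gives Q.

The factor set α depends only on cosets of N. So if J = N(J ∩ H), a projective representation of (J
∩ H)/M with factor set α'⁻¹ extends to J/N, which gives bijectivity. The inner product of tr(Q ⊗ P)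
and tr(R ⊗ P) is the average of tr Q(g) · tr R(g⁻¹) · α(g, g⁻¹), a function on J/N whose only trace
of P is α; hence the isometry. Under conjugation by H, tr(P⁻¹) and tr P' pick up reciprocal ratios
of factor set values, which cancel since α restricts to α'.

For (e), an extension of θ yields a Q of degree one. When J/N is abelian, every member of Irr(J ∣ θ)
comes from a twist of Q by a linear character of J/N, and surjectivity amounts to extending linear
characters from a subgroup of a finite abelian group. -/

noncomputable section

namespace CharTriples

open Representation Module

/-! ### Characters: passage to matrices, sums, products, pullbacks. -/

section CharacterTheory

variable {G : Type*} [Group G]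

/-- The representation by matrices on coordinate vectors. -/
def matRep {ι : Type*} [Fintype ι] [DecidableEq ι] (R : G →* Matrix ι ι ℂ) :
    Representation ℂ G (ι → ℂ) :=
  (Matrix.toLinAlgEquiv' : Matrix ι ι ℂ ≃ₐ[ℂ] _).toMonoidHom.comp R

lemma matRep_apply {ι : Type*} [Fintype ι] [DecidableEq ι] (R : G →* Matrix ι ι ℂ) (g : G) :
    matRep R g = Matrix.toLin' (R g) := rfl

lemma character_matRep {ι : Type*} [Fintype ι] [DecidableEq ι] (R : G →* Matrix ι ι ℂ) (g : G) :
    (matRep R).character g = (R g).trace := by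
  rw [character, matRep_apply, Matrix.trace_toLin'_eq]

/-- The matrices of a representation on coordinate vectors. -/
def repMat {n : ℕ} (ρ : Representation ℂ G (Fin n → ℂ)) : G →* Matrix (Fin n) (Fin n) ℂ :=
  (LinearMap.toMatrixAlgEquiv' : _ ≃ₐ[ℂ] Matrix (Fin n) (Fin n) ℂ).toMonoidHom.comp ρ

lemma trace_repMat {n : ℕ} (ρ : Representation ℂ G (Fin n → ℂ)) (g : G) :
    (repMat ρ g).trace = ρ.character g :=
  (LinearMap.trace_eq_matrix_trace ℂ (Pi.basisFun ℂ (Fin n)) (ρ g)).symm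

lemma exists_equiv_fin {V : Type*} [AddCommGroup V] [Module ℂ V] [FiniteDimensional ℂ V]
    (ρ : Representation ℂ G V) :
    ∃ σ : Representation ℂ G (Fin (finrank ℂ V) → ℂ), Nonempty (ρ.Equiv σ) := by
  let e : V ≃ₗ[ℂ] (Fin (finrank ℂ V) → ℂ) := (finBasis ℂ V).equivFun
  refine ⟨⟨⟨fun g => e.conj (ρ g), ?_⟩, ?_⟩, ⟨Representation.Equiv.mk e ?_⟩⟩
  · ext; simp
  · intro x y; ext; simp
  · intro g; ext; simp

/-- A `G`-invariant subspace is also invariant under `H` acting through `f`. With `f` the identity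
this is isomorphism invariance; otherwise it lifts irreducibility from a pullback. -/
lemma isIrreducible_of_linearEquiv {V W : Type*} [AddCommGroup V] [Module ℂ V] [AddCommGroup W]
    [Module ℂ W] {H : Type*} [Group H] (f : H →* G) {ρ : Representation ℂ G V}
    {σ : Representation ℂ H W} (e : V ≃ₗ[ℂ] W) (he : ∀ h v, e (ρ (f h) v) = σ h (e v))
    [hσ : σ.IsIrreducible] : ρ.IsIrreducible := by
  have hnt : Nontrivial V := by
    by_contra hV
    rw [not_nontrivial_iff_subsingleton] at hV
    have : Subsingleton W := e.symm.toEquiv.subsingleton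
    exact bot_ne_top (α := Subrepresentation σ)
      (Subrepresentation.toSubmodule_injective (Subsingleton.elim _ _))
  refine { toNontrivial := ⟨⊥, ⊤, fun h => ?_⟩, eq_bot_or_eq_top := fun p => ?_ }
  · exact bot_ne_top (α := Submodule ℂ V) (congrArg Subrepresentation.toSubmodule h)
  · let q : Subrepresentation σ := ⟨p.toSubmodule.map (e : V →ₗ[ℂ] W), by
      rintro h _ ⟨v, hv, rfl⟩
      exact ⟨ρ (f h) v, p.apply_mem_toSubmodule _ hv, he h v⟩⟩
    rcases hσ.eq_bot_or_eq_top q with hq | hq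
    · left
      apply Subrepresentation.toSubmodule_injective
      exact (Submodule.map_eq_bot_iff (p := p.toSubmodule) (e := e)).1
        (congrArg Subrepresentation.toSubmodule hq)
    · right
      apply Subrepresentation.toSubmodule_injective
      exact (Submodule.map_eq_top_iff (p := p.toSubmodule) (e := e)).1
        (congrArg Subrepresentation.toSubmodule hq)

lemma character_mem_charSet {V : Type*} [AddCommGroup V] [Module ℂ V] [FiniteDimensional ℂ V]
    [Nontrivial V] (ρ : Representation ℂ G V) : ρ.character ∈ charSet G := by
  obtain ⟨σ, ⟨e⟩⟩ := exists_equiv_fin ρ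
  exact ⟨_, σ, finrank_pos, char_iso e⟩

lemma nontrivial_of_isIrreducible {V : Type*} [AddCommGroup V] [Module ℂ V]
    (ρ : Representation ℂ G V) [ρ.IsIrreducible] : Nontrivial V := by
  by_contra hV
  rw [not_nontrivial_iff_subsingleton] at hV
  exact bot_ne_top (α := Subrepresentation ρ)
    (Subrepresentation.toSubmodule_injective (Subsingleton.elim _ _))

lemma irr_subset_charSet : irr G ⊆ charSet G := by
  rintro _ ⟨n, ρ, hρ, rfl⟩
  have := nontrivial_of_isIrreducible ρ
  exact character_mem_charSet ρ

lemma add_mem_charSet {χ ψ : G → ℂ} (hχ : χ ∈ charSet G) (hψ : ψ ∈ charSet G) :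
    χ + ψ ∈ charSet G := by
  obtain ⟨n, ρ, hn, rfl⟩ := hχ
  obtain ⟨m, σ, hm, rfl⟩ := hψ
  have : NeZero n := ⟨hn.ne'⟩
  convert character_mem_charSet (ρ.prod σ) using 1
  ext g
  exact (LinearMap.trace_prodMap' (ρ g) (σ g)).symm

lemma mul_mem_charSet {χ ψ : G → ℂ} (hχ : χ ∈ charSet G) (hψ : ψ ∈ charSet G) :
    χ * ψ ∈ charSet G := by
  obtain ⟨n, ρ, hn, rfl⟩ := hχ
  obtain ⟨m, σ, hm, rfl⟩ := hψ
  have : NeZero n := ⟨hn.ne'⟩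
  have : NeZero m := ⟨hm.ne'⟩
  have : Nontrivial (TensorProduct ℂ (Fin n → ℂ) (Fin m → ℂ)) := by
    apply nontrivial_of_finrank_pos (R := ℂ)
    rw [finrank_tensorProduct]
    simp [hn, hm]
  rw [← char_tensor]
  exact character_mem_charSet (ρ.tprod σ)

lemma comp_mem_charSet {H : Type*} [Group H] (f : H →* G) {χ : G → ℂ} (hχ : χ ∈ charSet G) :
    (fun x => χ (f x)) ∈ charSet H := by
  obtain ⟨n, ρ, hn, rfl⟩ := hχ
  exact ⟨n, ρ.comp f, hn, rfl⟩

lemma apply_conj_of_mem_charSet {χ : G → ℂ} (hχ : χ ∈ charSet G) (g h : G) :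
    χ (h * g * h⁻¹) = χ g := by
  obtain ⟨n, ρ, hn, rfl⟩ := hχ
  exact char_conj ρ g h

end CharacterTheory

/-! ### Inner products, intertwining maps and Schur orthogonality. -/

section InnerProduct

variable {G : Type*} [Group G] [Finite G]

-- Unitary trick: averaging ρ(x)ᴴρ(x) gives a positive definite B with ρ(g)ᴴB = Bρ(g⁻¹), so ρ(g)ᴴ
-- and ρ(g⁻¹) are similar.
open scoped Matrix ComplexOrder in
lemma star_apply_of_mem_charSet {χ : G → ℂ} (hχ : χ ∈ charSet G) (g : G) :
    star (χ g) = χ g⁻¹ := by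
  obtain ⟨n, ρ, hn, rfl⟩ := hχ
  classical
  have := Fintype.ofFinite G
  set B : Matrix (Fin n) (Fin n) ℂ := ∑ x : G, (repMat ρ x)ᴴ * repMat ρ x with hB
  have hBpos : B.PosDef := by
    rw [hB, ← Finset.add_sum_erase _ _ (Finset.mem_univ 1)]
    refine Matrix.PosDef.add_posSemidef (by simpa using Matrix.PosDef.one) ?_
    exact Matrix.posSemidef_sum _ fun x _ => Matrix.posSemidef_conjTranspose_mul_self _
  have hBinv : (repMat ρ g)ᴴ * B = B * repMat ρ g⁻¹ := by
    have h1 : (repMat ρ g)ᴴ * B * repMat ρ g = B := by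
      rw [hB, Finset.mul_sum, Finset.sum_mul]
      refine Fintype.sum_equiv (Equiv.mulRight g) _ _ fun x => ?_
      simp [Matrix.conjTranspose_mul, Matrix.mul_assoc]
    have h2 : repMat ρ g * repMat ρ g⁻¹ = 1 := by rw [← map_mul]; simp
    calc (repMat ρ g)ᴴ * B = (repMat ρ g)ᴴ * B * (repMat ρ g * repMat ρ g⁻¹) := by
          rw [h2, mul_one]
      _ = _ := by rw [← mul_assoc, h1]
  obtain ⟨u, hu⟩ := hBpos.isUnit
  rw [← trace_repMat, ← trace_repMat, ← Matrix.trace_conjTranspose]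
  have : (repMat ρ g)ᴴ = u * repMat ρ g⁻¹ * (u⁻¹ : _ˣ) := by
    rw [hu, ← hBinv, ← hu, mul_assoc, Units.mul_inv, mul_one]
  rw [this, Matrix.trace_mul_comm, ← mul_assoc, Units.inv_mul, one_mul]

lemma innerProd_eq_sum [Fintype G] (χ : G → ℂ) {ψ : G → ℂ} (hψ : ψ ∈ charSet G) :
    innerProd χ ψ = (Nat.card G : ℂ)⁻¹ * ∑ g, χ g * ψ g⁻¹ := by
  simp only [innerProd, finsum_eq_sum_of_fintype, star_apply_of_mem_charSet hψ]

lemma innerProd_character {V W : Type*} [AddCommGroup V] [Module ℂ V] [FiniteDimensional ℂ V]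
    [AddCommGroup W] [Module ℂ W] [FiniteDimensional ℂ W] [Nontrivial V]
    (ρ : Representation ℂ G V) (σ : Representation ℂ G W) :
    innerProd σ.character ρ.character = finrank ℂ (IntertwiningMap ρ σ) := by
  have := Fintype.ofFinite G
  have : Invertible (Nat.card G : ℂ) := invertibleOfNonzero (by simp)
  rw [innerProd_eq_sum _ (character_mem_charSet ρ), card_inv_mul_sum_char_mul_char_eq_finrank]

lemma innerProd_self_of_mem_irr {χ : G → ℂ} (hχ : χ ∈ irr G) : innerProd χ χ = 1 := by
  obtain ⟨n, ρ, hρ, rfl⟩ := hχ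
  have := nontrivial_of_isIrreducible ρ
  rw [innerProd_character]
  simp

lemma exists_injective_of_innerProd_ne_zero {V W : Type*} [AddCommGroup V] [Module ℂ V]
    [FiniteDimensional ℂ V] [AddCommGroup W] [Module ℂ W] [FiniteDimensional ℂ W]
    (ρ : Representation ℂ G V) [ρ.IsIrreducible] (σ : Representation ℂ G W)
    (h : innerProd σ.character ρ.character ≠ 0) :
    ∃ f : IntertwiningMap ρ σ, Function.Injective f := by
  have := nontrivial_of_isIrreducible ρ
  rw [innerProd_character] at h
  have : Nontrivial (IntertwiningMap ρ σ) := by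
    by_contra hc
    rw [not_nontrivial_iff_subsingleton] at hc
    exact h (by simp [finrank_zero_of_subsingleton])
  obtain ⟨f, hf⟩ := exists_ne (0 : IntertwiningMap ρ σ)
  exact ⟨f, (IsIrreducible.injective_or_eq_zero f).resolve_right hf⟩

lemma innerProd_ne_zero_of_ne_zero {V W : Type*} [AddCommGroup V] [Module ℂ V]
    [FiniteDimensional ℂ V] [AddCommGroup W] [Module ℂ W] [FiniteDimensional ℂ W] [Nontrivial V]
    {ρ : Representation ℂ G V} {σ : Representation ℂ G W} (f : IntertwiningMap ρ σ) (hf : f ≠ 0) :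
    innerProd σ.character ρ.character ≠ 0 := by
  rw [innerProd_character]
  have : Nontrivial (IntertwiningMap ρ σ) := ⟨f, 0, hf⟩
  exact_mod_cast (finrank_pos (R := ℂ) (M := IntertwiningMap ρ σ)).ne'

lemma eq_of_mem_irr {χ ψ : G → ℂ} (hχ : χ ∈ irr G) (hψ : ψ ∈ irr G) (h : innerProd χ ψ ≠ 0) :
    ψ = χ := by
  obtain ⟨n, ρ, hρ, rfl⟩ := hχ
  obtain ⟨m, σ, hσ, rfl⟩ := hψ
  obtain ⟨f, hf⟩ := exists_injective_of_innerProd_ne_zero σ ρ h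
  refine char_iso (f.ofBijective ((IsIrreducible.bijective_or_eq_zero f).resolve_right ?_))
  rintro rfl
  have := nontrivial_of_isIrreducible σ
  obtain ⟨v, hv⟩ := exists_ne (0 : Fin m → ℂ)
  exact hv (hf (by simp))

/-- Irreducibility depends only on the character: an irreducible σ with the same character embeds in
ρ, and equality of degrees makes the embedding an isomorphism. -/
lemma isIrreducible_of_character_mem_irr {V : Type*} [AddCommGroup V] [Module ℂ V]
    [FiniteDimensional ℂ V] {ρ : Representation ℂ G V} (h : ρ.character ∈ irr G) :
    ρ.IsIrreducible := by
  have h1 := innerProd_self_of_mem_irr h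
  obtain ⟨m, σ, hσ, hc⟩ := h
  have h2 : innerProd ρ.character σ.character ≠ 0 := by rw [← hc, h1]; simp
  obtain ⟨f, hf⟩ := exists_injective_of_innerProd_ne_zero σ ρ h2
  have hd : finrank ℂ (Fin m → ℂ) = finrank ℂ V := by
    have := congrFun hc 1
    rw [char_one, char_one] at this
    exact_mod_cast this.symm
  let e := LinearEquiv.ofInjectiveOfFinrankEq f.toLinearMap hf hd
  refine isIrreducible_of_linearEquiv (σ := σ) (MonoidHom.id G) e.symm fun h v => ?_
  obtain ⟨w, rfl⟩ := e.surjective v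
  rw [LinearEquiv.symm_apply_eq, LinearEquiv.symm_apply_apply]
  exact (IntertwiningMap.isIntertwining _ _ f h w).symm

/-- Schur orthogonality of the matrix coefficients of an irreducible representation. -/
lemma sum_trace_smul {n : ℕ} [Fintype G] (R : G →* Matrix (Fin n) (Fin n) ℂ)
    (hR : (fun g => (R g).trace) ∈ irr G) (X : Matrix (Fin n) (Fin n) ℂ) :
    (n : ℂ) • ∑ g, (R g⁻¹ * X).trace • R g = (Nat.card G : ℂ) • X := by
  have hirr : (matRep R).IsIrreducible := by
    apply isIrreducible_of_character_mem_irr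
    convert hR using 1
    ext g
    exact character_matRep R g
  -- The average of R(g) Y R(g)⁻¹ commutes with R, so Schur's lemma makes it scalar; its trace
  -- identifies the scalar.
  have key : ∀ Y : Matrix (Fin n) (Fin n) ℂ,
      (n : ℂ) • ∑ g, R g * Y * R g⁻¹ = ((Nat.card G : ℂ) * Y.trace) • 1 := by
    intro Y
    set B := ∑ g, R g * Y * R g⁻¹ with hB
    have hcomm : ∀ x, B * R x = R x * B := by
      intro x
      rw [hB, Finset.sum_mul, Finset.mul_sum]
      refine Fintype.sum_equiv (Equiv.mulLeft x⁻¹) _ _ fun g => ?_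
      simp only [Equiv.coe_mulLeft, mul_inv_rev, inv_inv, map_mul, ← mul_assoc]
      rw [← map_mul R x, mul_inv_cancel, map_one, one_mul]
    obtain ⟨c, hc⟩ := (IsIrreducible.algebraMap_intertwiningMap_bijective_of_isAlgClosed
      (ρ := matRep R)).2 ⟨Matrix.toLin' B, fun x => by
        rw [matRep_apply, ← Matrix.toLin'_mul, hcomm, Matrix.toLin'_mul]⟩
    have hBc : B = c • 1 := by
      apply Matrix.toLin'.injective
      have := congrArg IntertwiningMap.toLinearMap hc
      rw [map_smul, Matrix.toLin'_one]
      exact this.symm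
    have htr : B.trace = (Nat.card G : ℂ) * Y.trace := by
      rw [hB, Matrix.trace_sum]
      have : ∀ g, (R g * Y * R g⁻¹).trace = Y.trace := fun g => by
        rw [Matrix.trace_mul_comm, ← mul_assoc, ← map_mul, inv_mul_cancel, map_one, one_mul]
      simp [this]
    rw [← htr, hBc, Matrix.trace_smul, Matrix.trace_one, smul_smul]
    simp [mul_comm]
  ext i j
  -- Taking Y to be a matrix unit in `key` gives the orthogonality of matrix coefficients.
  have h1 : ∀ k l : Fin n, (n : ℂ) * ∑ g, R g i j * R g⁻¹ k l =
      if i = l ∧ j = k then (Nat.card G : ℂ) else 0 := by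
    intro k l
    have := congrFun (congrFun (key (Matrix.single j k 1)) i) l
    simp only [Matrix.smul_apply, Matrix.sum_apply, smul_eq_mul, Matrix.one_apply] at this
    have e : ∀ g, (R g * Matrix.single j k (1 : ℂ) * R g⁻¹ : Matrix (Fin n) (Fin n) ℂ) i l =
        R g i j * R g⁻¹ k l := by
      intro g
      rw [Matrix.mul_apply, Finset.sum_eq_single k]
      · simp
      · intro b _ hb; simp [Matrix.mul_single_apply_of_ne, hb]
      · simp
    simp only [e] at this
    rw [this]
    by_cases hil : i = l <;> by_cases hjk : j = k
    · subst hjk; simp [hil]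
    · simp [hil, hjk]
    · simp [hil]
    · simp [hil]
  have h2 : ∀ g, ((R g⁻¹ * X).trace • R g) i j =
      ∑ k, ∑ l, X l k * (R g i j * R g⁻¹ k l) := by
    intro g
    simp only [Matrix.smul_apply, smul_eq_mul, Matrix.trace, Matrix.diag, Matrix.mul_apply,
      Finset.sum_mul]
    exact Finset.sum_congr rfl fun k _ => Finset.sum_congr rfl fun l _ => by ring
  rw [Matrix.smul_apply, Matrix.sum_apply, Finset.sum_congr rfl fun g _ => h2 g,
    Finset.sum_comm, smul_eq_mul, Finset.mul_sum]
  have h3 : ∀ k, (n : ℂ) * ∑ g, ∑ l, X l k * (R g i j * R g⁻¹ k l) =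
      ∑ l, X l k * if i = l ∧ j = k then (Nat.card G : ℂ) else 0 := by
    intro k
    rw [Finset.sum_comm, Finset.mul_sum]
    refine Finset.sum_congr rfl fun l _ => ?_
    rw [← Finset.mul_sum, ← h1]
    ring
  simp only [h3, Matrix.smul_apply, smul_eq_mul]
  rw [Finset.sum_eq_single j, Finset.sum_eq_single i]
  · simp [mul_comm]
  · intro b _ hb; simp [hb.symm]
  · simp
  · intro b _ hb; simp [hb.symm]
  · simp

end InnerProduct

/-! ### Irreducible subrepresentations, pullbacks and averages. -/

section Pullback

variable {G : Type*} [Group G]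

/-- The bound `d` on the dimension only serves the induction: a reducible space has a proper nonzero
subrepresentation of smaller dimension. -/
lemma exists_irreducible_injective (d : ℕ) {V : Type*} [AddCommGroup V] [Module ℂ V]
    [FiniteDimensional ℂ V] [Nontrivial V] (ρ : Representation ℂ G V) (hd : finrank ℂ V ≤ d) :
    ∃ (n : ℕ) (σ : Representation ℂ G (Fin n → ℂ)) (f : IntertwiningMap σ ρ),
      σ.IsIrreducible ∧ Function.Injective f := by
  induction d generalizing V with
  | zero => exact absurd hd (by simpa using (finrank_pos (R := ℂ) (M := V)).ne')
  | succ d ih =>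
    by_cases h : ρ.IsIrreducible
    · obtain ⟨σ, ⟨e⟩⟩ := exists_equiv_fin ρ
      exact ⟨_, σ, e.symm.toIntertwiningMap, isIrreducible_of_linearEquiv (MonoidHom.id G)
        e.symm.toLinearEquiv
          (fun h v => IntertwiningMap.isIntertwining _ _ e.symm.toIntertwiningMap h v),
        e.symm.injective⟩
    · obtain ⟨p, hp0, hp1⟩ : ∃ p : Subrepresentation ρ, p ≠ ⊥ ∧ p ≠ ⊤ := by
        by_contra! hc
        refine h { toNontrivial := ⟨⊥, ⊤, fun h => ?_⟩, eq_bot_or_eq_top := fun p => ?_ }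
        · exact bot_ne_top (α := Submodule ℂ V) (congrArg Subrepresentation.toSubmodule h)
        · exact or_iff_not_imp_left.2 (hc p)
      have h0 : p.toSubmodule ≠ ⊥ :=
        fun h => hp0 (Subrepresentation.toSubmodule_injective h)
      have h1 : p.toSubmodule ≠ ⊤ :=
        fun h => hp1 (Subrepresentation.toSubmodule_injective h)
      have : Nontrivial p.toSubmodule := Submodule.nontrivial_iff_ne_bot.2 h0
      have hlt := Submodule.finrank_lt h1
      obtain ⟨n, σ, f, hσ, hf⟩ := ih p.toRepresentation (by omega)
      refine ⟨n, σ, ⟨p.toSubmodule.subtype ∘ₗ f.toLinearMap, fun g => ?_⟩, hσ, ?_⟩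
      · refine LinearMap.ext fun v => ?_
        exact congrArg Subtype.val (IntertwiningMap.isIntertwining _ _ f g v)
      · exact Subtype.val_injective.comp hf

lemma mem_irr_of_comp_mem_irr {H : Type*} [Group H] [Finite H] (f : H →* G) {χ : G → ℂ}
    (hχ : χ ∈ charSet G) (h : (fun x => χ (f x)) ∈ irr H) : χ ∈ irr G := by
  obtain ⟨n, ρ, hn, rfl⟩ := hχ
  have : IsIrreducible (ρ.comp f : Representation ℂ H (Fin n → ℂ)) :=
    isIrreducible_of_character_mem_irr h
  exact ⟨n, ρ, isIrreducible_of_linearEquiv (σ := (ρ.comp f : Representation ℂ H (Fin n → ℂ))) f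
    (LinearEquiv.refl ℂ _) (fun _ _ => rfl), rfl⟩

/-- Averages over a finite group are unchanged by inflation. -/
lemma average_comp_surjective {Q : Type*} [Group Q] [Finite Q] [Fintype G] [Fintype Q]
    (π : G →* Q) (hπ : Function.Surjective π) (f : Q → ℂ) :
    (Nat.card G : ℂ)⁻¹ * ∑ g, f (π g) = (Nat.card Q : ℂ)⁻¹ * ∑ q, f q := by
  -- The double sum of f(π(g)q) over g and q is evaluated in both orders, by translation invariance
  -- in each variable.
  have h1 : ∀ q, ∑ g, f (π g * q) = ∑ g, f (π g) := by
    intro q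
    obtain ⟨x, rfl⟩ := hπ q
    exact Fintype.sum_equiv (Equiv.mulRight x) _ _ fun g => by simp
  have h2 : ∀ g, ∑ q, f (π g * q) = ∑ q, f q := fun g =>
    Fintype.sum_equiv (Equiv.mulLeft (π g)) _ _ fun q => by simp
  have h3 : ∑ q : Q, ∑ g, f (π g * q) = ∑ g, ∑ q, f (π g * q) := Finset.sum_comm
  simp only [h1, h2, Finset.sum_const, Finset.card_univ, nsmul_eq_mul, ← Nat.card_eq_fintype_card]
    at h3
  have hG : (Nat.card G : ℂ) ≠ 0 := by simp
  have hQ : (Nat.card Q : ℂ) ≠ 0 := by simp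
  field_simp
  linear_combination h3

end Pullback

/-! ### Trace functionals and idempotents in matrix algebras. -/

section MatrixAlgebra

/-- A trace-like functional on a matrix algebra is a multiple of the trace. -/
lemma eq_mul_trace_of_mul_comm {n : ℕ} (τ : Matrix (Fin n) (Fin n) ℂ →ₗ[ℂ] ℂ)
    (hτ : ∀ X Y, τ (X * Y) = τ (Y * X)) (i₀ : Fin n) (X : Matrix (Fin n) (Fin n) ℂ) :
    τ X = τ (Matrix.single i₀ i₀ 1) * X.trace := by
  have h1 : ∀ i j, τ (Matrix.single i j 1) = if i = j then τ (Matrix.single i₀ i₀ 1) else 0 := by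
    intro i j
    -- Swapping the two factors gives zero if i ≠ j, and the fixed diagonal unit at `i₀` if i = j.
    have h2 : Matrix.single i j (1 : ℂ) = Matrix.single i i₀ 1 * Matrix.single i₀ j 1 := by simp
    rw [h2, hτ]
    split_ifs with h
    · subst h; simp
    · rw [Matrix.single_mul_single_of_ne (h := Ne.symm h), map_zero]
  conv_lhs => rw [Matrix.matrix_eq_sum_single X]
  simp only [map_sum]
  have h3 : ∀ i j, τ (Matrix.single i j (X i j)) =
      X i j * if i = j then τ (Matrix.single i₀ i₀ 1) else 0 := by
    intro i j
    rw [← h1, ← smul_eq_mul, ← map_smul, Matrix.smul_single, smul_eq_mul, mul_one]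
  simp [h3, Matrix.trace, ← Finset.sum_mul, mul_comm]

/-- An idempotent is the identity on its range W: `C` is the map onto W and `B` the inclusion of W,
in a basis of W. -/
lemma exists_factorization_of_isIdempotentElem {k : ℕ} (p : Matrix (Fin k) (Fin k) ℂ)
    (hp : p * p = p) :
    ∃ (m : ℕ) (B : Matrix (Fin k) (Fin m) ℂ) (C : Matrix (Fin m) (Fin k) ℂ),
      B * C = p ∧ C * B = 1 := by
  let f := Matrix.toLin' p
  have hf : ∀ v, f (f v) = f v := fun v => by
    rw [← LinearMap.comp_apply, ← Matrix.toLin'_mul, hp]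
  let W := LinearMap.range f
  let b := finBasis ℂ W
  let e := Pi.basisFun ℂ (Fin k)
  refine ⟨_, LinearMap.toMatrix b e W.subtype, LinearMap.toMatrix e b f.rangeRestrict, ?_, ?_⟩
  · rw [← LinearMap.toMatrix_comp]
    exact LinearMap.toMatrix'_toLin' p
  · rw [← LinearMap.toMatrix_comp, ← LinearMap.toMatrix_id b]
    congr 1
    ext ⟨_, v, rfl⟩ : 2
    exact hf v

end MatrixAlgebra

/-! ### Frobenius reciprocity and characters over θ. -/

section Restriction

variable {A : Type*} [Group A] [Finite A]

open Classical in
omit [Finite A] in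
lemma sum_dite_mem {N J : Subgroup A} [Fintype N] [Fintype J] (h : N ≤ J) (f : N → ℂ) (F : J → ℂ) :
    ∑ g : J, (if hg : (g : A) ∈ N then f ⟨g, hg⟩ else 0) * F g =
      ∑ x : N, f x * F (Subgroup.inclusion h x) := by
  symm
  refine Finset.sum_of_injOn (Subgroup.inclusion h) (Subgroup.inclusion_injective h).injOn
    (by simp [Set.MapsTo]) (fun g _ hg => ?_) (fun x _ => ?_)
  · rw [dif_neg, zero_mul]
    exact fun hgN => hg ⟨⟨g, hgN⟩, by simp, rfl⟩
  · simp

/-- Frobenius reciprocity for an invariant character. -/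
lemma innerProd_ind (T : CharTriple A) {ψ : T.G → ℂ} (hψ : ψ ∈ charSet T.G) :
    innerProd (ind T.G T.θ) ψ = innerProd T.θ (res T.N_le ψ) := by
  classical
  have := Fintype.ofFinite T.G
  have := Fintype.ofFinite T.N
  -- By invariance of θ, the induced character is |G : N| θ on N and zero elsewhere.
  have h1 : ∀ g : T.G, ind T.G T.θ g = (Nat.card T.N : ℂ)⁻¹ * ((Nat.card T.G : ℂ) *
      if h : (g : A) ∈ T.N then T.θ ⟨g, h⟩ else 0) := by
    intro g
    rw [ind, finsum_eq_sum_of_fintype]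
    congr 1
    rw [Nat.card_eq_fintype_card, ← nsmul_eq_mul, ← Finset.card_univ, ← Finset.sum_const]
    refine Finset.sum_congr rfl fun x _ => ?_
    by_cases h : (g : A) ∈ T.N
    · rw [dif_pos h, dif_pos (T.conj_mem x x.2 g h)]
      exact T.θ_inv x x.2 ⟨g, h⟩
    · rw [dif_neg h, dif_neg]
      intro hx
      refine h ?_
      have := T.conj_mem _ (inv_mem x.2) _ hx
      simpa [mul_assoc] using this
  have hG : (Nat.card T.G : ℂ) ≠ 0 := by simp
  have h2 : res T.N_le ψ ∈ charSet T.N := comp_mem_charSet (Subgroup.inclusion T.N_le) hψ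
  rw [innerProd_eq_sum _ hψ, innerProd_eq_sum _ h2]
  simp only [h1, mul_assoc]
  rw [← Finset.mul_sum, ← Finset.mul_sum, sum_dite_mem T.N_le T.θ fun g => ψ g⁻¹]
  field_simp
  rfl

/-- An embedding of a constituent ψ into χ restricts to a nonzero N-map, so the restriction of ψ is
not orthogonal to cθ; Frobenius reciprocity then puts ψ over θ. -/
lemma mem_charOver_of_res_eq_mul (T : CharTriple A) {χ : T.G → ℂ} (hχ : χ ∈ charSet T.G) (c : ℂ)
    (hc : ∀ x : T.N, χ (Subgroup.inclusion T.N_le x) = c * T.θ x) : χ ∈ charOver T.G T.θ := by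
  refine ⟨hχ, fun ψ hψ => ⟨hψ.1, ?_⟩⟩
  rw [innerProd_ind T (irr_subset_charSet hψ.1)]
  obtain ⟨n, ρ, hn, rfl⟩ := hχ
  obtain ⟨⟨m, σ, hσ, rfl⟩, hne⟩ := hψ
  obtain ⟨f, hf⟩ := exists_injective_of_innerProd_ne_zero σ ρ hne
  have := nontrivial_of_isIrreducible σ
  let ι := Subgroup.inclusion T.N_le
  let σ' : Representation ℂ T.N (Fin m → ℂ) := σ.comp ι
  let ρ' : Representation ℂ T.N (Fin n → ℂ) := ρ.comp ι
  let f' : IntertwiningMap σ' ρ' := ⟨f.toLinearMap, fun g => f.isIntertwining' (ι g)⟩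
  have hf' : f' ≠ 0 := by
    intro h
    obtain ⟨v, hv⟩ := exists_ne (0 : Fin m → ℂ)
    refine hv (hf ?_)
    rw [map_zero]
    exact congrArg (fun k : IntertwiningMap σ' ρ' => k v) h
  have h1 := innerProd_ne_zero_of_ne_zero f' hf'
  have h2 : ρ'.character = c • T.θ := funext hc
  have h3 : innerProd ρ'.character σ'.character = c * innerProd T.θ (res T.N_le σ.character) := by
    rw [h2]
    simp only [innerProd, Pi.smul_apply, smul_eq_mul, mul_assoc]
    have := Fintype.ofFinite T.N
    rw [finsum_eq_sum_of_fintype, finsum_eq_sum_of_fintype, ← Finset.mul_sum, mul_left_comm]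
    rfl
  rw [h3] at h1
  exact right_ne_zero_of_mul h1

end Restriction

/-! ### Projective representations associated with a triple; duality on cosets. -/

namespace ProjRep

variable {A : Type*} [Group A] {n m : ℕ}

lemma tensorTrace_apply {G : Type*} [Group G] (Q : ProjRep G m) (P : ProjRep G n) (g : G) :
    Q.tensorTrace P g = (Q.toFun g).val.trace * (P.toFun g).val.trace :=
  Matrix.trace_kronecker _ _

namespace IsAssociated

variable {T : CharTriple A} {P : ProjRep T.G n} (hP : P.IsAssociated T)

include hP

lemma restrict {J : Subgroup A} (hNJ : T.N ≤ J) (hJG : J ≤ T.G) :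
    IsAssociated (T.restrict J hNJ hJG) (P.res hJG) where
  map_mul := hP.map_mul
  affords := hP.affords
  map_mul_left x g := hP.map_mul_left x (Subgroup.inclusion hJG g)
  map_mul_right x g := hP.map_mul_right x (Subgroup.inclusion hJG g)

lemma map_one : P.toFun 1 = 1 := by
  have := hP.map_mul 1 1
  simpa using this

/-- P(1) = 1 forces α(1,1) = 1, so Q(1) is an invertible idempotent. -/
lemma toFun_one_of_hasInverseFactorSet {Q : ProjRep T.G m} (hQP : Q.HasInverseFactorSet P) :
    Q.toFun 1 = 1 := by
  have h1 : Q.factorSet 1 1 = 1 := by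
    rw [hQP]
    have := P.mul_eq 1 1
    rw [mul_one, hP.map_one] at this
    have h4 := congrFun (congrFun this ⟨0, P.pos⟩) ⟨0, P.pos⟩
    simp only [Units.val_one, mul_one, Matrix.smul_apply, Matrix.one_apply_eq, smul_eq_mul]
      at h4
    rw [inv_eq_one]
    exact (Units.ext h4).symm
  have := Q.mul_eq 1 1
  rw [h1, mul_one, Units.val_one, one_smul] at this
  have h2 : Q.toFun 1 * Q.toFun 1 = Q.toFun 1 := Units.ext this
  exact mul_eq_left.1 h2

lemma map_inv (x : T.N) :
    P.toFun (Subgroup.inclusion T.N_le x⁻¹) = (P.toFun (Subgroup.inclusion T.N_le x))⁻¹ := by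
  rw [eq_inv_iff_mul_eq_one, ← hP.map_mul, inv_mul_cancel, _root_.map_one, hP.map_one]

/-- The linear representation of `N` given by an associated projective representation. -/
def normalRep : T.N →* Matrix (Fin n) (Fin n) ℂ where
  toFun x := (P.toFun (Subgroup.inclusion T.N_le x)).val
  map_one' := by rw [_root_.map_one, hP.map_one]; rfl
  map_mul' x y := by rw [hP.map_mul]; rfl

lemma trace_normalRep : (fun x => (hP.normalRep x).trace) = T.θ := funext hP.affords

lemma conj_mul (g : T.G) (x : T.N) :
    P.toFun (Subgroup.inclusion T.N_le ⟨g * x * (g : A)⁻¹, T.conj_mem g g.2 x x.2⟩) * P.toFun g =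
      P.toFun g * P.toFun (Subgroup.inclusion T.N_le x) := by
  rw [← hP.map_mul_left, ← hP.map_mul_right]
  congr 1
  ext
  simp

/-- The factor set lives on G/N. Moving the N-parts of both arguments to the far right collects them
into one element c of N, and P(c) cancels from both sides. -/
lemma factorSet_congr {x y x' y' : T.G} (hx : (x : A)⁻¹ * x' ∈ T.N) (hy : (y : A)⁻¹ * y' ∈ T.N) :
    P.factorSet x' y' = P.factorSet x y := by
  obtain ⟨a, rfl⟩ : ∃ a : T.N, x' = x * Subgroup.inclusion T.N_le a :=
    ⟨⟨_, hx⟩, by ext; simp⟩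
  obtain ⟨b, rfl⟩ : ∃ b : T.N, y' = y * Subgroup.inclusion T.N_le b :=
    ⟨⟨_, hy⟩, by ext; simp⟩
  have hc := T.conj_mem (y : A)⁻¹ (inv_mem y.2) a a.2
  rw [inv_inv] at hc
  let c : T.N := ⟨_, hc⟩ * b
  have e1 : x * Subgroup.inclusion T.N_le a * (y * Subgroup.inclusion T.N_le b) =
      x * y * Subgroup.inclusion T.N_le c := by
    ext; simp [c, mul_assoc]
  have e2 : P.toFun (Subgroup.inclusion T.N_le a) * P.toFun (y * Subgroup.inclusion T.N_le b) =
      P.toFun y * P.toFun (Subgroup.inclusion T.N_le c) := by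
    rw [← hP.map_mul_left, ← hP.map_mul_right]
    congr 1
    ext; simp [c, mul_assoc]
  have h1 := P.mul_eq (x * Subgroup.inclusion T.N_le a) (y * Subgroup.inclusion T.N_le b)
  rw [e1, hP.map_mul_right a x, hP.map_mul_right c, ← Units.val_mul, mul_assoc, e2, ← mul_assoc,
    Units.val_mul, Units.val_mul, P.mul_eq, Units.val_mul, ← smul_mul_assoc] at h1
  have h2 := (P.toFun (Subgroup.inclusion T.N_le c)).isUnit.mul_right_cancel h1
  have h3 := congrArg (fun M => M * ((P.toFun (x * y))⁻¹ : _ˣ).val) h2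
  simp only [smul_mul_assoc, Units.mul_inv] at h3
  have h4 := congrFun (congrFun h3 ⟨0, P.pos⟩) ⟨0, P.pos⟩
  simp only [Matrix.smul_apply, Matrix.one_apply_eq, smul_eq_mul, mul_one] at h4
  exact (Units.ext h4).symm

variable [Finite A]

lemma sum_normalRep [Fintype T.N] (X : Matrix (Fin n) (Fin n) ℂ) :
    (n : ℂ) • ∑ x, (hP.normalRep x⁻¹ * X).trace • hP.normalRep x = (Nat.card T.N : ℂ) • X :=
  sum_trace_smul _ (by rw [hP.trace_normalRep]; exact T.θ_irr) X

/-- The characters of `P` and of its contragredient are dual on each coset of `N`. -/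
lemma sum_trace_mul_trace_inv [Fintype T.N] (g : T.G) :
    ∑ x : T.N, (P.toFun (g * Subgroup.inclusion T.N_le x)).val.trace *
      (P.toFun (g * Subgroup.inclusion T.N_le x))⁻¹.val.trace = Nat.card T.N := by
  -- Schur orthogonality for the matrix P(g)⁻¹, multiplied by P(g) and traced.
  have h1 := congrArg (fun M => ((P.toFun g).val * M).trace)
    (hP.sum_normalRep (P.toFun g)⁻¹.val)
  have hn : (n : ℂ) ≠ 0 := by exact_mod_cast P.pos.ne'
  simp only [Matrix.mul_smul, Matrix.trace_smul, Matrix.mul_sum, Matrix.trace_sum, Units.mul_inv,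
    Matrix.trace_one, Fintype.card_fin, smul_eq_mul] at h1
  rw [mul_comm (Nat.card T.N : ℂ)] at h1
  rw [← mul_left_cancel₀ hn h1]
  refine Finset.sum_congr rfl fun x _ => ?_
  rw [hP.map_mul_right, mul_inv_rev, ← hP.map_inv]
  exact mul_comm _ _

/-- The inversion formula behind `cofactor`: tr Q is constant on gN and comes out of the duality
sum. -/
lemma sum_tensorTrace_mul [Fintype T.N] {Q : ProjRep T.G m} (hQ : Q.IsInflated T.N) (g : T.G) :
    ∑ x : T.N, Q.tensorTrace P (g * Subgroup.inclusion T.N_le x) *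
      (P.toFun (g * Subgroup.inclusion T.N_le x))⁻¹.val.trace =
      Nat.card T.N * (Q.toFun g).val.trace := by
  rw [← hP.sum_trace_mul_trace_inv g, Finset.sum_mul]
  refine Finset.sum_congr rfl fun x _ => ?_
  rw [tensorTrace_apply, ← hQ g (g * Subgroup.inclusion T.N_le x) (by simp)]
  ring

/-- Inverse factor sets cancel, so Q ⊗ P is linear; on N it is a sum of m copies of P, because Q is
trivial there. -/
lemma tensorTrace_mem_charOver {Q : ProjRep T.G m} (hQ : Q.IsInflated T.N)
    (hQP : Q.HasInverseFactorSet P) : Q.tensorTrace P ∈ charOver T.G T.θ := by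
  have hQ1 := hP.toFun_one_of_hasInverseFactorSet hQP
  let R : T.G →* Matrix (Fin m × Fin n) (Fin m × Fin n) ℂ :=
    { toFun := fun g => Matrix.kronecker (Q.toFun g).val (P.toFun g).val
      map_one' := by
        rw [hQ1, hP.map_one]
        exact Matrix.one_kronecker_one
      map_mul' := fun g h => by
        have h1 : (Q.factorSet g h : ℂ) * P.factorSet g h = 1 := by
          rw [hQP, ← Units.val_mul, inv_mul_cancel, Units.val_one]
        have := Matrix.mul_kronecker_mul (Q.toFun g).val (Q.toFun h).val (P.toFun g).val
          (P.toFun h).val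
        rw [Q.mul_eq, P.mul_eq, Matrix.smul_kronecker, Matrix.kronecker_smul, smul_smul, h1,
          one_smul] at this
        exact this }
  have hpos : NeZero m := ⟨Q.pos.ne'⟩
  have hpos' : NeZero n := ⟨P.pos.ne'⟩
  refine mem_charOver_of_res_eq_mul T ?_ m fun x => ?_
  · convert character_mem_charSet (matRep R) using 1
    ext g
    rw [character_matRep]
    rfl
  · rw [tensorTrace_apply, ← hQ 1 (Subgroup.inclusion T.N_le x) (by simp), hQ1,
      ← hP.affords x]
    simp

end IsAssociated

end ProjRep

/-! ### Factoring a representation over θ as Q ⊗ P. -/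

namespace ProjRep.IsAssociated

variable {A : Type*} [Group A] {n k : ℕ} {T : CharTriple A} {P : ProjRep T.G n}
  (hP : P.IsAssociated T) [Fintype T.N] (r : T.G →* Matrix (Fin k) (Fin k) ℂ)

include hP

/-- The homomorphism from the algebra spanned by the matrices of `P` on `N` to the algebra
spanned by those of `r`, matching the images of `N` in the `θ`-isotypic part of `r`. -/
def isotypicMap : Matrix (Fin n) (Fin n) ℂ →ₗ[ℂ] Matrix (Fin k) (Fin k) ℂ where
  toFun X := ((n : ℂ) / Nat.card T.N) •
    ∑ x : T.N, (hP.normalRep x⁻¹ * X).trace • r (Subgroup.inclusion T.N_le x)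
  map_add' X Y := by
    simp only [mul_add, Matrix.trace_add, add_smul, Finset.sum_add_distrib, smul_add]
  map_smul' c X := by
    simp only [Matrix.mul_smul, Matrix.trace_smul, smul_assoc, ← Finset.smul_sum,
      RingHom.id_apply]
    rw [smul_comm]

lemma isotypicMap_apply (X : Matrix (Fin n) (Fin n) ℂ) :
    hP.isotypicMap r X = ((n : ℂ) / Nat.card T.N) •
      ∑ x : T.N, (hP.normalRep x⁻¹ * X).trace • r (Subgroup.inclusion T.N_le x) := rfl

/-- Conjugation by r(g) on the image corresponds to conjugation by P(g) on the source: reindex the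
sum by x ↦ gxg⁻¹ and use `conj_mul`. -/
lemma map_mul_isotypicMap (g : T.G) (X : Matrix (Fin n) (Fin n) ℂ) :
    r g * hP.isotypicMap r X =
      hP.isotypicMap r ((P.toFun g).val * X * (P.toFun g)⁻¹.val) * r g := by
  rw [isotypicMap_apply, isotypicMap_apply, mul_smul_comm, smul_mul_assoc, Finset.mul_sum,
    Finset.sum_mul]
  congr 1
  let e : T.N ≃ T.N :=
    { toFun := fun x => ⟨g * x * (g : A)⁻¹, T.conj_mem g g.2 x x.2⟩
      invFun := fun x => ⟨(g : A)⁻¹ * x * g, by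
        simpa using T.conj_mem _ (inv_mem g.2) x x.2⟩
      left_inv := fun x => by ext; simp [mul_assoc]
      right_inv := fun x => by ext; simp [mul_assoc] }
  refine Fintype.sum_equiv e _ _ fun x => ?_
  have h1 : r (Subgroup.inclusion T.N_le (e x)) * r g = r g * r (Subgroup.inclusion T.N_le x) := by
    rw [← _root_.map_mul, ← _root_.map_mul]
    congr 1
    ext; simp [e]
  have h2 : hP.normalRep (e x)⁻¹ * (P.toFun g).val = (P.toFun g).val * hP.normalRep x⁻¹ := by
    have h3 : (e x)⁻¹ = e x⁻¹ := by ext; simp [e, mul_assoc]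
    rw [h3]
    exact congrArg Units.val (hP.conj_mul g x⁻¹)
  have h3 : (hP.normalRep (e x)⁻¹ * ((P.toFun g).val * X * (P.toFun g)⁻¹.val)).trace =
      (hP.normalRep x⁻¹ * X).trace := by
    rw [← mul_assoc, ← mul_assoc, h2, Matrix.trace_mul_comm, ← mul_assoc, ← mul_assoc,
      Units.inv_mul, one_mul]
  rw [mul_smul_comm, smul_mul_assoc, h1, h3]

lemma isotypicMap_mul_apply (X : Matrix (Fin n) (Fin n) ℂ) (y : T.N) :
    hP.isotypicMap r X * r (Subgroup.inclusion T.N_le y) =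
      hP.isotypicMap r (X * hP.normalRep y) := by
  rw [isotypicMap_apply, isotypicMap_apply, smul_mul_assoc, Finset.sum_mul]
  congr 1
  refine Fintype.sum_equiv (Equiv.mulRight y) _ _ fun x => ?_
  have h1 : (hP.normalRep (x * y)⁻¹ * (X * hP.normalRep y)).trace =
      (hP.normalRep x⁻¹ * X).trace := by
    rw [← mul_assoc, Matrix.trace_mul_comm, ← mul_assoc, ← _root_.map_mul, mul_inv_rev,
      mul_inv_cancel_left]
  rw [Equiv.coe_mulRight, smul_mul_assoc, h1, _root_.map_mul, _root_.map_mul]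

variable [Finite A]

/-- Schur orthogonality expands Y in the matrices P(x), x ∈ N, which reduces multiplicativity to
right translation by elements of N. -/
lemma isotypicMap_mul (X Y : Matrix (Fin n) (Fin n) ℂ) :
    hP.isotypicMap r X * hP.isotypicMap r Y = hP.isotypicMap r (X * Y) := by
  have hN : (Nat.card T.N : ℂ) ≠ 0 := by simp
  have h1 : Y = ((n : ℂ) / Nat.card T.N) •
      ∑ x, (hP.normalRep x⁻¹ * Y).trace • hP.normalRep x := by
    rw [div_eq_inv_mul, mul_smul, hP.sum_normalRep, smul_smul, inv_mul_cancel₀ hN, one_smul]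
  conv_rhs => rw [h1]
  rw [isotypicMap_apply hP r Y, mul_smul_comm, mul_smul_comm, map_smul, Finset.mul_sum,
    Finset.mul_sum, map_sum]
  congr 1
  refine Finset.sum_congr rfl fun x _ => ?_
  rw [mul_smul_comm, mul_smul_comm, map_smul, hP.isotypicMap_mul_apply]

/-- The image of 1 is the action of the central idempotent of θ. An irreducible σ inside its kernel
would be a constituent of ρ, hence over θ; but the trace of ∑ θ(x⁻¹)σ(x) = 0 says that σ on N is
orthogonal to θ. An injective idempotent is 1. -/
lemma isotypicMap_one_of_mem_charOver (ρ : Representation ℂ T.G (Fin k → ℂ))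
    (h : ρ.character ∈ charOver T.G T.θ) : hP.isotypicMap (repMat ρ) 1 = 1 := by
  set e := hP.isotypicMap (repMat ρ) 1 with he
  have hc : ((n : ℂ) / Nat.card T.N) ≠ 0 :=
    div_ne_zero (by exact_mod_cast P.pos.ne') (by simp)
  have hee : e * e = e := by rw [he, hP.isotypicMap_mul, mul_one]
  have hcomm : ∀ g, repMat ρ g * e = e * repMat ρ g := fun g => by
    rw [he, hP.map_mul_isotypicMap, mul_one, Units.mul_inv]
  have hlin : ∀ g, Matrix.toLin' (repMat ρ g) = ρ g := fun g => Matrix.toLin'_toMatrix' _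
  have happ : ∀ v, Matrix.toLin' e v = ((n : ℂ) / Nat.card T.N) •
      ∑ x : T.N, T.θ x⁻¹ • ρ (Subgroup.inclusion T.N_le x) v := by
    intro v
    rw [he, isotypicMap_apply, map_smul, map_sum]
    simp only [map_smul, LinearMap.smul_apply, LinearMap.sum_apply, hlin, mul_one,
      ← hP.trace_normalRep]
  have hker : LinearMap.ker (Matrix.toLin' e) = ⊥ := by
    by_contra hne
    let W : Subrepresentation ρ := ⟨LinearMap.ker (Matrix.toLin' e), fun g v hv => by
      rw [LinearMap.mem_ker] at hv ⊢
      rw [← hlin, ← LinearMap.comp_apply, ← Matrix.toLin'_mul, ← hcomm, Matrix.toLin'_mul,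
        LinearMap.comp_apply, hv, map_zero]⟩
    have : Nontrivial W.toSubmodule := Submodule.nontrivial_iff_ne_bot.2 hne
    obtain ⟨m, σ, f, hσ, hf⟩ := exists_irreducible_injective _ W.toRepresentation le_rfl
    have := nontrivial_of_isIrreducible σ
    have hfcomm : ∀ g v, (f (σ g v) : Fin k → ℂ) = ρ g (f v) := fun g v =>
      congrArg Subtype.val (IntertwiningMap.isIntertwining _ _ f g v)
    let f' : IntertwiningMap σ ρ :=
      ⟨W.toSubmodule.subtype ∘ₗ f.toLinearMap, fun g => LinearMap.ext (hfcomm g)⟩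
    have hf' : f' ≠ 0 := by
      intro h0
      obtain ⟨v, hv⟩ := exists_ne (0 : Fin m → ℂ)
      refine hv (hf (Subtype.ext ?_))
      rw [map_zero]
      exact congrArg (fun l : IntertwiningMap σ ρ => l v) h0
    have h1 := (h.2 _ ⟨⟨m, σ, hσ, rfl⟩, innerProd_ne_zero_of_ne_zero f' hf'⟩).2
    have hcs := character_mem_charSet σ
    rw [innerProd_ind T hcs, innerProd_eq_sum _
      (show CharTriples.res T.N_le σ.character ∈ charSet T.N from
        comp_mem_charSet (Subgroup.inclusion T.N_le) hcs)] at h1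
    refine h1 ?_
    have h2 : ∑ x : T.N, T.θ x⁻¹ • σ (Subgroup.inclusion T.N_le x) = 0 := by
      refine LinearMap.ext fun v => hf (Subtype.ext ?_)
      have h3 : Matrix.toLin' e (f v) = 0 := (f v).2
      rw [happ, smul_eq_zero_iff_right hc] at h3
      simp only [LinearMap.sum_apply, LinearMap.smul_apply, map_sum, map_smul,
        LinearMap.zero_apply, map_zero]
      rw [AddSubmonoidClass.coe_finsetSum, ZeroMemClass.coe_zero, ← h3]
      refine Finset.sum_congr rfl fun x _ => ?_
      rw [← hfcomm]
      rfl
    have h4 := congrArg (LinearMap.trace ℂ _) h2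
    simp only [map_sum, map_smul, map_zero, smul_eq_mul] at h4
    rw [mul_eq_zero]
    right
    rw [← h4]
    exact Fintype.sum_equiv (Equiv.inv _) _ _ fun x => by
      rw [Equiv.inv_apply, inv_inv]
      rfl
  have hinj := LinearMap.ker_eq_bot.1 hker
  apply Matrix.toLin'.injective
  refine LinearMap.ext fun v => hinj ?_
  rw [← LinearMap.comp_apply, ← Matrix.toLin'_mul, hee, Matrix.toLin'_one, LinearMap.id_apply]

omit [Fintype T.N] in
/-- Every character over `θ` is the trace of a tensor product with `P`. -/
theorem exists_eq_tensorTrace {χ : T.G → ℂ} (hχ : χ ∈ charOver T.G T.θ) :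
    ∃ (m : ℕ) (Q : ProjRep T.G m), Q.IsInflated T.N ∧ Q.HasInverseFactorSet P ∧
      χ = Q.tensorTrace P := by
  have := Fintype.ofFinite T.N
  obtain ⟨k, ρ, hk, rfl⟩ := hχ.1
  let r := repMat ρ
  let Φ := hP.isotypicMap r
  have hΦ1 : Φ 1 = 1 := hP.isotypicMap_one_of_mem_charOver ρ hχ
  have hΦm : ∀ X Y, Φ X * Φ Y = Φ (X * Y) := hP.isotypicMap_mul r
  have hΦN : ∀ x : T.N, r (Subgroup.inclusion T.N_le x) =
      Φ (P.toFun (Subgroup.inclusion T.N_le x)).val := fun x => by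
    have := hP.isotypicMap_mul_apply r 1 x
    rw [one_mul] at this
    rw [← one_mul (r _), ← hΦ1]
    exact this
  -- Dividing r by the copy of P inside Φ leaves the candidate for Q, acting on the whole space with
  -- multiplicity n.
  let q : T.G → Matrix (Fin k) (Fin k) ℂ := fun g => r g * Φ (P.toFun g)⁻¹.val
  have hrq : ∀ g, r g = q g * Φ (P.toFun g).val := fun g => by
    rw [mul_assoc, hΦm, Units.inv_mul, hΦ1, mul_one]
  have hqΦ : ∀ g X, q g * Φ X = Φ X * q g := fun g X => by
    have h1 := hP.map_mul_isotypicMap r g ((P.toFun g)⁻¹.val * X)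
    have h2 := hP.map_mul_isotypicMap r g (P.toFun g)⁻¹.val
    rw [← mul_assoc, Units.mul_inv, one_mul] at h1
    rw [Units.mul_inv, one_mul] at h2
    change r g * Φ _ * Φ X = Φ X * (r g * Φ _)
    rw [mul_assoc, hΦm]
    refine h1.trans ?_
    refine Eq.trans ?_ (congrArg (fun M => Φ X * M) h2).symm
    rw [← mul_assoc]
    exact congrArg (fun M => M * r g) (hΦm _ _).symm
  have hq1 : q 1 = 1 := by
    change r 1 * Φ _ = 1
    rw [hP.map_one, inv_one, Units.val_one, hΦ1, _root_.map_one, one_mul]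
  have hqmul : ∀ g h, q g * q h = ((P.factorSet g h)⁻¹ : ℂˣ).val • q (g * h) := fun g h => by
    have h1 : q g * q h * Φ ((P.toFun g).val * (P.toFun h).val) = r (g * h) := by
      rw [_root_.map_mul r, hrq g, hrq h, ← hΦm, mul_assoc, ← mul_assoc (q h), hqΦ h]
      simp only [mul_assoc]
    rw [P.mul_eq, map_smul, mul_smul_comm] at h1
    have h2 := congrArg (fun M => M * Φ (P.toFun (g * h))⁻¹.val) h1
    simp only [smul_mul_assoc, mul_assoc, hΦm, Units.mul_inv, hΦ1, mul_one] at h2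
    change _ = _ • (r (g * h) * Φ _)
    rw [← h2, smul_smul, ← Units.val_mul, inv_mul_cancel, Units.val_one, one_smul]
  -- Compressing to the range of a diagonal matrix unit removes the multiplicity; this range is
  -- stable because q commutes with Φ.
  let i₀ : Fin n := ⟨0, P.pos⟩
  obtain ⟨m, B, C, hBC, hCB⟩ := exists_factorization_of_isIdempotentElem
    (Φ (Matrix.single i₀ i₀ 1)) (by rw [hΦm]; simp)
  let Q : T.G → Matrix (Fin m) (Fin m) ℂ := fun g => C * q g * B
  have hQmul : ∀ g h, Q g * Q h = ((P.factorSet g h)⁻¹ : ℂˣ).val • Q (g * h) := fun g h => by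
    calc Q g * Q h = C * (q g * (B * C) * q h) * B := by simp only [Q, Matrix.mul_assoc]
      _ = C * (B * C * (q g * q h)) * B := by rw [hBC, hqΦ]; simp only [Matrix.mul_assoc]
      _ = (C * B) * (C * (q g * q h) * B) := by simp only [Matrix.mul_assoc]
      _ = _ := by rw [hCB, hqmul, Matrix.one_mul, Matrix.mul_smul, Matrix.smul_mul]
  have hQ1 : Q 1 = 1 := by simp only [Q, hq1, Matrix.mul_one, hCB]
  -- X ↦ tr(q(g)Φ(X)) is a trace functional, hence a multiple of tr; its value at the matrix unit,
  -- tr Q(g), is the factor.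
  have hQtr : ∀ g, (Q g).trace * (P.toFun g).val.trace = ρ.character g := fun g => by
    let τ : Matrix (Fin n) (Fin n) ℂ →ₗ[ℂ] ℂ :=
      Matrix.traceLinearMap (Fin k) ℂ ℂ ∘ₗ LinearMap.mulLeft ℂ (q g) ∘ₗ Φ
    have hτ : ∀ X Y, τ (X * Y) = τ (Y * X) := fun X Y => by
      change (q g * Φ (X * Y)).trace = (q g * Φ (Y * X)).trace
      rw [← hΦm, ← hΦm, ← mul_assoc, hqΦ, mul_assoc, Matrix.trace_mul_comm, mul_assoc]
    rw [← trace_repMat]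
    change _ = (r g).trace
    rw [hrq g]
    change _ = τ (P.toFun g).val
    rw [eq_mul_trace_of_mul_comm τ hτ i₀]
    congr 1
    change _ = (q g * Φ _).trace
    rw [← hBC]
    simp only [Q]
    rw [Matrix.mul_assoc, Matrix.trace_mul_comm, Matrix.mul_assoc]
  have hm : 0 < m := by
    rcases Nat.eq_zero_or_pos m with rfl | hm
    · have h1 := hQtr 1
      rw [char_one] at h1
      simp at h1
      exact absurd h1.symm (by exact_mod_cast hk.ne')
    · exact hm
  have hunit : ∀ g, Q g * (P.factorSet g g⁻¹ : ℂ) • Q g⁻¹ = 1 := fun g => by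
    rw [mul_smul_comm, hQmul, smul_smul, ← Units.val_mul, mul_inv_cancel, Units.val_one, one_smul,
      mul_inv_cancel, hQ1]
  refine ⟨m, ⟨fun g => ⟨Q g, _, hunit g, mul_eq_one_comm.1 (hunit g)⟩,
    fun g h => (P.factorSet g h)⁻¹, hm, hQmul⟩, fun x y hxy => ?_, fun _ _ => rfl, ?_⟩
  · refine Units.ext ?_
    change Q x = Q y
    obtain ⟨a, rfl⟩ : ∃ a : T.N, y = x * Subgroup.inclusion T.N_le a :=
      ⟨⟨_, hxy⟩, by ext; simp⟩
    have h1 : q (x * Subgroup.inclusion T.N_le a) = q x := by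
      change r _ * Φ _ = r x * Φ _
      rw [_root_.map_mul, hΦN, hP.map_mul_right, mul_assoc, hΦm, mul_inv_rev, Units.val_mul,
        ← mul_assoc _ _ (P.toFun x)⁻¹.val, Units.mul_inv, one_mul]
    simp only [Q, h1]
  · ext g
    rw [tensorTrace_apply]
    exact (hQtr g).symm

end ProjRep.IsAssociated

/-! ### Extension by zero, conjugation and products of subgroups. -/

section Subgroups

variable {A : Type*} [Group A]

open Classical in
/-- Extension of a function on a subgroup by zero. -/
def extendZero {J : Subgroup A} (χ : J → ℂ) (a : A) : ℂ := if h : a ∈ J then χ ⟨a, h⟩ else 0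

lemma extendZero_of_mem {J : Subgroup A} (χ : J → ℂ) {a : A} (h : a ∈ J) :
    extendZero χ a = χ ⟨a, h⟩ := dif_pos h

lemma extendZero_of_notMem {J : Subgroup A} (χ : J → ℂ) {a : A} (h : a ∉ J) :
    extendZero χ a = 0 := dif_neg h

lemma mem_conjSub {a x : A} {J : Subgroup A} : x ∈ conjSub a J ↔ a * x * a⁻¹ ∈ J := Iff.rfl

lemma extendZero_conjChar (a : A) {J : Subgroup A} (χ : J → ℂ) (x : A) :
    extendZero (conjChar a (le_refl (conjSub a J)) χ) x = extendZero χ (a * x * a⁻¹) := by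
  by_cases h : x ∈ conjSub a J
  · rw [extendZero_of_mem _ h, extendZero_of_mem _ (mem_conjSub.1 h)]
    rfl
  · rw [extendZero_of_notMem _ h, extendZero_of_notMem _ (mt mem_conjSub.2 h)]

lemma extendZero_conj {J : Subgroup A} {χ : J → ℂ} (hχ : χ ∈ charSet J) {b : A} (hb : b ∈ J)
    (x : A) : extendZero χ (b * x * b⁻¹) = extendZero χ x := by
  by_cases h : x ∈ J
  · rw [extendZero_of_mem _ h, extendZero_of_mem _ (J.mul_mem (J.mul_mem hb h) (J.inv_mem hb))]
    exact apply_conj_of_mem_charSet hχ ⟨x, h⟩ ⟨b, hb⟩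
  · rw [extendZero_of_notMem _ h, extendZero_of_notMem]
    intro hx
    refine h ?_
    simpa [mul_assoc] using J.mul_mem (J.mul_mem (J.inv_mem hb) hx) hb

lemma charQuot_apply_mul {N J : Subgroup A} {β : J → ℂ} (hβ : β ∈ charQuot N J) (y x : J)
    (hx : (x : A) ∈ N) : β (y * x) = β y := by
  obtain ⟨k, ρ, -, hρ, rfl⟩ := hβ
  rw [character, map_mul, hρ x hx, mul_one]
  rfl

/-- The elements of `N K`, if `K` normalizes `N`. -/
lemma exists_inv_mul_mem_of_mem_sup {N K : Subgroup A}
    (hK : ∀ k ∈ K, ∀ x ∈ N, k * x * k⁻¹ ∈ N) {a : A} (ha : a ∈ N ⊔ K) :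
    ∃ k ∈ K, a⁻¹ * k ∈ N := by
  -- The elements with a coset representative in K form a subgroup containing N and K.
  let L : Subgroup A :=
    { carrier := {a | ∃ k ∈ K, a⁻¹ * k ∈ N}
      one_mem' := ⟨1, K.one_mem, by simp [N.one_mem]⟩
      mul_mem' := by
        rintro a b ⟨k, hk, hak⟩ ⟨l, hl, hbl⟩
        refine ⟨k * l, K.mul_mem hk hl, ?_⟩
        have := N.mul_mem hbl (hK _ (K.inv_mem hl) _ hak)
        convert this using 1
        group
      inv_mem' := by
        rintro a ⟨k, hk, hak⟩
        refine ⟨k⁻¹, K.inv_mem hk, ?_⟩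
        have := N.inv_mem (hK k hk _ hak)
        convert this using 1
        group }
  have hL : N ⊔ K ≤ L := sup_le (fun x hx => ⟨1, K.one_mem, by simpa using hx⟩)
    (fun x hx => ⟨x, hx, by simp [N.one_mem]⟩)
  exact hL ha

end Subgroups

namespace CharTriple

variable {A : Type*} [Group A]

lemma conjSub_le (T : CharTriple A) {J : Subgroup A} (hJG : J ≤ T.G) {a : A} (ha : a ∈ T.G) :
    conjSub a J ≤ T.G := by
  intro x hx
  have := T.G.mul_mem (T.G.mul_mem (T.G.inv_mem ha) (hJG (mem_conjSub.1 hx))) ha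
  simpa [mul_assoc] using this

lemma le_conjSub (T : CharTriple A) {J : Subgroup A} (hNJ : T.N ≤ J) {a : A} (ha : a ∈ T.G) :
    T.N ≤ conjSub a J := fun x hx => mem_conjSub.2 (hNJ (T.conj_mem a ha x hx))

end CharTriple

/-! ### Traces under conjugation, and recovering tr Q from tr(Q ⊗ P). -/

namespace ProjRep

variable {A : Type*} [Group A] {n m : ℕ}

/-- Both products are multiples of P(gz). The traces of P and of P⁻¹ at a conjugate follow, with
reciprocal scalars. -/
lemma factorSet_smul_conj {G : Type*} [Group G] (P : ProjRep G n) (g z : G) :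
    (P.factorSet (g * z * g⁻¹) g : ℂ) • ((P.toFun g).val * (P.toFun z).val) =
      (P.factorSet g z : ℂ) • ((P.toFun (g * z * g⁻¹)).val * (P.toFun g).val) := by
  rw [P.mul_eq, P.mul_eq, inv_mul_cancel_right, smul_comm]

lemma trace_conj {G : Type*} [Group G] (P : ProjRep G n) (g z : G) :
    (P.factorSet g z : ℂ) * (P.toFun (g * z * g⁻¹)).val.trace =
      P.factorSet (g * z * g⁻¹) g * (P.toFun z).val.trace := by
  have := congrArg (fun M => (M * (P.toFun g)⁻¹.val).trace) (P.factorSet_smul_conj g z)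
  simp only [smul_mul_assoc, Matrix.trace_smul, smul_eq_mul] at this
  rw [mul_assoc (P.toFun (g * z * g⁻¹)).val, Units.mul_inv, mul_one, Matrix.trace_mul_comm,
    ← mul_assoc, Units.inv_mul, one_mul] at this
  exact this.symm

lemma trace_inv_conj {G : Type*} [Group G] (P : ProjRep G n) (g z : G) :
    P.factorSet (g * z * g⁻¹) g * (P.toFun (g * z * g⁻¹))⁻¹.val.trace =
      (P.factorSet g z : ℂ) * (P.toFun z)⁻¹.val.trace := by
  have := congrArg (fun M => ((P.toFun (g * z * g⁻¹))⁻¹.val * M *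
    ((P.toFun z)⁻¹.val * (P.toFun g)⁻¹.val)).trace) (P.factorSet_smul_conj g z)
  simp only [smul_mul_assoc, mul_smul_comm, Matrix.trace_smul, smul_eq_mul] at this
  convert this using 2
  · simp only [mul_assoc, Units.mul_inv_cancel_left, Units.mul_inv, mul_one]
  · rw [Units.inv_mul_cancel_left, ← mul_assoc, Matrix.trace_mul_comm, ← mul_assoc,
      Units.inv_mul, one_mul]

lemma trace_inv_eq {G : Type*} [Group G] (P : ProjRep G n) (h1 : P.toFun 1 = 1) (g : G) :
    (P.toFun g⁻¹).val.trace = P.factorSet g g⁻¹ * (P.toFun g)⁻¹.val.trace := by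
  have := congrArg (fun M => ((P.toFun g)⁻¹.val * M).trace) (P.mul_eq g g⁻¹)
  simpa [h1] using this

variable {T : CharTriple A} (P : ProjRep T.G n) [Fintype T.N]

/-- The linear map taking `tr(Q ⊗ P)` to `tr Q`. -/
def cofactor (J : Subgroup A) : (J → ℂ) →ₗ[ℂ] (A → ℂ) where
  toFun χ a := (Nat.card T.N : ℂ)⁻¹ * ∑ x : T.N, extendZero χ (a * x) *
    extendZero (fun g => (P.toFun g)⁻¹.val.trace) (a * x)
  map_add' χ ψ := by
    ext a
    simp only [Pi.add_apply, ← mul_add, ← Finset.sum_add_distrib]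
    congr 1
    refine Finset.sum_congr rfl fun x _ => ?_
    rw [← add_mul]
    congr 1
    unfold extendZero
    split_ifs <;> simp
  map_smul' c χ := by
    ext a
    simp only [Pi.smul_apply, smul_eq_mul, RingHom.id_apply]
    rw [mul_left_comm, Finset.mul_sum _ _ c]
    congr 1
    refine Finset.sum_congr rfl fun x _ => ?_
    rw [← mul_assoc]
    congr 1
    unfold extendZero
    split_ifs <;> simp

lemma cofactor_apply (J : Subgroup A) (χ : J → ℂ) (a : A) :
    P.cofactor J χ a = (Nat.card T.N : ℂ)⁻¹ * ∑ x : T.N, extendZero χ (a * x) *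
      extendZero (fun g => (P.toFun g)⁻¹.val.trace) (a * x) := rfl

lemma cofactor_res {K J : Subgroup A} (hKJ : K ≤ J) (hNK : T.N ≤ K) (χ : J → ℂ) {a : A}
    (ha : a ∈ K) : P.cofactor K (CharTriples.res hKJ χ) a = P.cofactor J χ a := by
  simp only [cofactor_apply]
  congr 1
  refine Finset.sum_congr rfl fun x _ => ?_
  have hax := K.mul_mem ha (hNK x.2)
  rw [extendZero_of_mem _ hax, extendZero_of_mem χ (hKJ hax)]
  rfl

lemma cofactor_mul {J : Subgroup A} (hNJ : T.N ≤ J) (χ β : J → ℂ)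
    (hβ : ∀ y x : J, (x : A) ∈ T.N → β (y * x) = β y) (y : J) :
    P.cofactor J (χ * β) y = P.cofactor J χ y * β y := by
  simp only [cofactor_apply]
  rw [mul_assoc, Finset.sum_mul]
  congr 1
  refine Finset.sum_congr rfl fun x _ => ?_
  have hax := J.mul_mem y.2 (hNJ x.2)
  have := hβ y ⟨x, hNJ x.2⟩ x.2
  rw [extendZero_of_mem _ hax, extendZero_of_mem χ hax, Pi.mul_apply, ← this]
  exact mul_right_comm _ _ _

variable {P}

lemma IsAssociated.cofactor_tensorTrace [Finite A] (hP : P.IsAssociated T) {J : Subgroup A}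
    (hNJ : T.N ≤ J) (hJG : J ≤ T.G) {Q : ProjRep J m} (hQ : Q.IsInflated T.N) (x : J) :
    P.cofactor J (Q.tensorTrace (P.res hJG)) x = (Q.toFun x).val.trace := by
  let _ : Fintype (T.restrict J hNJ hJG).N := ‹Fintype T.N›
  have h1 := (hP.restrict hNJ hJG).sum_tensorTrace_mul hQ x
  rw [cofactor_apply, inv_mul_eq_iff_eq_mul₀ (by simp)]
  refine Eq.trans (Finset.sum_congr rfl fun y _ => ?_) h1
  have hxy := J.mul_mem x.2 (hNJ y.2)
  rw [extendZero_of_mem _ hxy, extendZero_of_mem _ (hJG hxy)]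
  rfl

end ProjRep

/-! ### Closure properties of Char(J ∣ θ) and inner products. -/

namespace ProjRep.IsAssociated

variable {A : Type*} [Group A] [Finite A] {n m : ℕ} {T : CharTriple A} {P : ProjRep T.G n}
  (hP : P.IsAssociated T)

include hP

lemma exists_eq_tensorTrace_res {J : Subgroup A} (hNJ : T.N ≤ J) (hJG : J ≤ T.G) {χ : J → ℂ}
    (hχ : χ ∈ charOver J T.θ) : ∃ (m : ℕ) (Q : ProjRep J m), Q.IsInflated T.N ∧
      Q.HasInverseFactorSet (P.res hJG) ∧ χ = Q.tensorTrace (P.res hJG) :=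
  (hP.restrict hNJ hJG).exists_eq_tensorTrace hχ

/-- The characters over `θ` are the ones whose restriction is a multiple of `θ`. -/
lemma mem_charOver_iff {J : Subgroup A} (hNJ : T.N ≤ J) (hJG : J ≤ T.G) {χ : J → ℂ} :
    χ ∈ charOver J T.θ ↔
      χ ∈ charSet J ∧ ∃ c : ℂ, ∀ x : T.N, χ ⟨x, hNJ x.2⟩ = c * T.θ x := by
  refine ⟨fun h => ⟨h.1, ?_⟩, fun ⟨h, c, hc⟩ =>
    mem_charOver_of_res_eq_mul (T.restrict J hNJ hJG) h c hc⟩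
  obtain ⟨m, Q, hQ, -, rfl⟩ := hP.exists_eq_tensorTrace_res hNJ hJG h
  refine ⟨(Q.toFun 1).val.trace, fun x => ?_⟩
  rw [tensorTrace_apply, ← hP.affords, hQ 1 ⟨x, hNJ x.2⟩ (by simp)]
  rfl

lemma add_mem_charOver {J : Subgroup A} (hNJ : T.N ≤ J) (hJG : J ≤ T.G) {χ ψ : J → ℂ}
    (hχ : χ ∈ charOver J T.θ) (hψ : ψ ∈ charOver J T.θ) : χ + ψ ∈ charOver J T.θ := by
  rw [hP.mem_charOver_iff hNJ hJG] at *
  obtain ⟨h1, c, hc⟩ := hχ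
  obtain ⟨h2, d, hd⟩ := hψ
  exact ⟨add_mem_charSet h1 h2, c + d, fun x => by rw [Pi.add_apply, hc, hd, add_mul]⟩

lemma res_mem_charOver {K J : Subgroup A} (hKJ : K ≤ J) (hNK : T.N ≤ K) (hJG : J ≤ T.G)
    {χ : J → ℂ} (hχ : χ ∈ charOver J T.θ) : CharTriples.res hKJ χ ∈ charOver K T.θ := by
  rw [hP.mem_charOver_iff (hNK.trans hKJ) hJG] at hχ
  rw [hP.mem_charOver_iff hNK (hKJ.trans hJG)]
  obtain ⟨h1, c, hc⟩ := hχ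
  exact ⟨comp_mem_charSet (Subgroup.inclusion hKJ) h1, c, hc⟩

lemma conjChar_mem_charOver {J : Subgroup A} (hNJ : T.N ≤ J) (hJG : J ≤ T.G) {a : A}
    (ha : a ∈ T.G) {χ : J → ℂ} (hχ : χ ∈ charOver J T.θ) :
    conjChar a le_rfl χ ∈ charOver (conjSub a J) T.θ := by
  rw [hP.mem_charOver_iff hNJ hJG] at hχ
  rw [hP.mem_charOver_iff (T.le_conjSub hNJ ha) (T.conjSub_le hJG ha)]
  obtain ⟨h1, c, hc⟩ := hχ
  let f : conjSub a J →* J :=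
    { toFun := fun x => ⟨a * x * a⁻¹, x.2⟩
      map_one' := by ext; simp
      map_mul' := fun x y => by ext; simp [mul_assoc] }
  refine ⟨comp_mem_charSet f h1, c, fun x => ?_⟩
  rw [← T.θ_inv a ha x]
  exact hc ⟨_, T.conj_mem a ha x x.2⟩

lemma mul_mem_charOver {J : Subgroup A} (hNJ : T.N ≤ J) (hJG : J ≤ T.G) {χ β : J → ℂ}
    (hχ : χ ∈ charOver J T.θ) (hβ : β ∈ charQuot T.N J) : χ * β ∈ charOver J T.θ := by
  rw [hP.mem_charOver_iff hNJ hJG] at *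
  obtain ⟨h1, c, hc⟩ := hχ
  have hβ' : β ∈ charSet J := by
    obtain ⟨k, ρ, hk, -, h⟩ := hβ
    exact ⟨k, ρ, hk, h⟩
  refine ⟨mul_mem_charSet h1 hβ', c * β 1, fun x => ?_⟩
  have := charQuot_apply_mul hβ 1 ⟨x, hNJ x.2⟩ x.2
  rw [one_mul] at this
  rw [Pi.mul_apply, this, hc]
  ring

omit [Finite A] in
lemma trace_mul_factorSet_congr {m' : ℕ} {Q : ProjRep T.G m} {Q' : ProjRep T.G m'}
    (hQ : Q.IsInflated T.N) (hQ' : Q'.IsInflated T.N) {g g' : T.G} (h : (g : A)⁻¹ * g' ∈ T.N) :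
    (Q.toFun g').val.trace * (Q'.toFun g'⁻¹).val.trace * P.factorSet g' g'⁻¹ =
      (Q.toFun g).val.trace * (Q'.toFun g⁻¹).val.trace * (P.factorSet g g⁻¹ : ℂ) := by
  have h3 : (((g⁻¹ : T.G) : A))⁻¹ * (g'⁻¹ : T.G) ∈ T.N := by
    have := T.conj_mem g g.2 _ (T.N.inv_mem h)
    simpa [mul_assoc] using this
  rw [← hQ g g' h, ← hQ' _ _ h3, hP.factorSet_congr h h3]

/-- The inner product of characters over `θ` in terms of the cofactors of `P`. -/
lemma innerProd_tensorTrace [Fintype T.G] {m' : ℕ} {Q : ProjRep T.G m} {Q' : ProjRep T.G m'}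
    (hQ : Q.IsInflated T.N) (hQ' : Q'.IsInflated T.N) (hQP' : Q'.HasInverseFactorSet P) :
    innerProd (Q.tensorTrace P) (Q'.tensorTrace P) = (Nat.card T.G : ℂ)⁻¹ *
      ∑ g, (Q.toFun g).val.trace * (Q'.toFun g⁻¹).val.trace * P.factorSet g g⁻¹ := by
  have := Fintype.ofFinite T.N
  rw [innerProd_eq_sum _ (hP.tensorTrace_mem_charOver hQ' hQP').1]
  congr 1
  set f : T.G → ℂ := fun g =>
    (Q.toFun g).val.trace * (Q'.toFun g⁻¹).val.trace * P.factorSet g g⁻¹ with hf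
  let t : T.G → ℂ := fun g => (P.toFun g).val.trace * (P.toFun g)⁻¹.val.trace
  have h1 : ∀ g, Q.tensorTrace P g * Q'.tensorTrace P g⁻¹ = f g * t g := fun g => by
    rw [tensorTrace_apply, tensorTrace_apply, P.trace_inv_eq hP.map_one]
    simp only [f, t]
    ring
  have h2 : ∀ (x : T.N) g, f (g * Subgroup.inclusion T.N_le x) = f g := fun x g =>
    hP.trace_mul_factorSet_congr hQ hQ' (by simp)
  -- Since f is constant on cosets of N, t may be averaged over each coset, where the duality makes
  -- its mean 1.
  have h3 : (Nat.card T.N : ℂ) * ∑ g, f g * t g = Nat.card T.N * ∑ g, f g := by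
    calc (Nat.card T.N : ℂ) * ∑ g, f g * t g = ∑ x : T.N, ∑ g, f g * t g := by
          simp [Nat.card_eq_fintype_card]
      _ = ∑ x : T.N, ∑ g, f g * t (g * Subgroup.inclusion T.N_le x) := by
          refine Finset.sum_congr rfl fun x _ => ?_
          symm
          refine Fintype.sum_equiv (Equiv.mulRight (Subgroup.inclusion T.N_le x)) _ _ fun g => ?_
          rw [Equiv.coe_mulRight, h2]
      _ = ∑ g, f g * ∑ x : T.N, t (g * Subgroup.inclusion T.N_le x) := by
          rw [Finset.sum_comm]
          simp only [Finset.mul_sum]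
      _ = _ := by
          simp only [t, hP.sum_trace_mul_trace_inv]
          rw [← Finset.sum_mul, mul_comm]
  simp only [h1]
  exact mul_left_cancel₀ (by simp) h3

end ProjRep.IsAssociated

/-! ### The maps σ_J: compatibilities, bijectivity and isometry. -/

section CharacterMap

open ProjRep

variable {A : Type*} [Group A] {n n' m : ℕ} {T S : CharTriple A} {P : ProjRep T.G n}
  {P' : ProjRep S.G n'}

/-- The map `tr(Q ⊗ P) ↦ tr(Q ⊗ P')`. -/
def charMap (P : ProjRep T.G n) (P' : ProjRep S.G n') [Fintype T.N] (J : Subgroup A) :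
    (J → ℂ) →ₗ[ℂ] (↥(J ⊓ S.G) → ℂ) where
  toFun χ y := P.cofactor J χ y * (P'.toFun (Subgroup.inclusion inf_le_right y)).val.trace
  map_add' χ ψ := by ext; simp [add_mul]
  map_smul' c χ := by ext; simp [mul_assoc]

lemma charMap_apply [Fintype T.N] (J : Subgroup A) (χ : J → ℂ) (y : ↥(J ⊓ S.G)) :
    charMap P P' J χ y =
      P.cofactor J χ y * (P'.toFun (Subgroup.inclusion inf_le_right y)).val.trace := rfl

lemma CharTriple.proj_eq_proj_iff (T : CharTriple A) {g g' : T.G} :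
    T.proj g = T.proj g' ↔ (g : A)⁻¹ * g' ∈ T.N := by
  change (g : T.G ⧸ T.N.subgroupOf T.G) = g' ↔ _
  rw [QuotientGroup.eq, Subgroup.mem_subgroupOf]
  rfl

/-- Averaging a function on `G / N` over a subgroup that covers `G / N`. -/
lemma CharTriple.average_eq_of_forall_exists [Finite A] (T : CharTriple A) {K : Type*} [Group K]
    [Fintype K] [Fintype T.G] (ι : K →* T.G) (hι : ∀ g : T.G, ∃ k, (g : A)⁻¹ * ι k ∈ T.N)
    (f : T.G → ℂ) (hf : ∀ g g' : T.G, (g : A)⁻¹ * g' ∈ T.N → f g' = f g) :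
    (Nat.card T.G : ℂ)⁻¹ * ∑ g, f g = (Nat.card K : ℂ)⁻¹ * ∑ k, f (ι k) := by
  have := Fintype.ofFinite T.Quot
  have hπ : Function.Surjective T.proj := QuotientGroup.mk'_surjective _
  let F : T.Quot → ℂ := fun q => f (Function.surjInv hπ q)
  have hF : ∀ g, F (T.proj g) = f g := fun g =>
    hf _ _ (T.proj_eq_proj_iff.1 (Function.surjInv_eq hπ (T.proj g)).symm)
  have hπ' : Function.Surjective (T.proj.comp ι) := by
    intro q
    obtain ⟨x, rfl⟩ := hπ q
    obtain ⟨k, hk⟩ := hι x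
    exact ⟨k, (T.proj_eq_proj_iff.2 hk).symm⟩
  -- Both averages equal the average of F over G/N.
  have h1 := average_comp_surjective T.proj hπ F
  have h2 := average_comp_surjective _ hπ' F
  simp only [MonoidHom.comp_apply, hF] at h1 h2
  exact h1.trans h2.symm

namespace GivesRel

variable (h : GivesRel T S P P')

include h

lemma mem_N_iff {x : A} (hx : x ∈ S.G) : x ∈ S.N ↔ x ∈ T.N := by
  rw [← h.inf_eq, Subgroup.mem_inf]
  exact and_iff_left hx

lemma N_le_N : S.N ≤ T.N := h.inf_eq ▸ inf_le_left

lemma N_le_inf {J : Subgroup A} (hNJ : T.N ≤ J) : S.N ≤ J ⊓ S.G :=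
  le_inf (h.N_le_N.trans hNJ) S.N_le

lemma isInflated_res {J : Subgroup A} {Q : ProjRep J m} (hQ : Q.IsInflated T.N) :
    (Q.res (inf_le_left : J ⊓ S.G ≤ J)).IsInflated S.N :=
  fun _ _ hxy => hQ _ _ (h.N_le_N hxy)

lemma hasInverseFactorSet_res {J : Subgroup A} (hJG : J ≤ T.G) {Q : ProjRep J m}
    (hQ : Q.HasInverseFactorSet (P.res hJG)) :
    (Q.res (inf_le_left : J ⊓ S.G ≤ J)).HasInverseFactorSet (P'.res inf_le_right) := fun x y => by
  refine (hQ _ _).trans (congrArg _ ?_)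
  exact h.factorSet_eq (Subgroup.inclusion inf_le_right x) (Subgroup.inclusion inf_le_right y)

variable [Finite A]

lemma charMap_tensorTrace [Fintype T.N] {J : Subgroup A} (hNJ : T.N ≤ J) (hJG : J ≤ T.G)
    {Q : ProjRep J m} (hQ : Q.IsInflated T.N) :
    charMap P P' J (Q.tensorTrace (P.res hJG)) =
      (Q.res inf_le_left : ProjRep ↥(J ⊓ S.G) m).tensorTrace (P'.res inf_le_right) := by
  ext y
  rw [charMap_apply, tensorTrace_apply]
  exact congrArg (· * _)
    (h.assoc.cofactor_tensorTrace hNJ hJG hQ (Subgroup.inclusion inf_le_left y))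

lemma mapsTo_charMap [Fintype T.N] {J : Subgroup A} (hNJ : T.N ≤ J) (hJG : J ≤ T.G) :
    Set.MapsTo (charMap P P' J) (charOver J T.θ) (charOver (J ⊓ S.G) S.θ) := by
  intro χ hχ
  obtain ⟨m, Q, hQ, hQP, rfl⟩ := h.assoc.exists_eq_tensorTrace_res hNJ hJG hχ
  rw [h.charMap_tensorTrace hNJ hJG hQ]
  exact (h.assoc'.restrict (h.N_le_inf hNJ) inf_le_right).tensorTrace_mem_charOver
    (h.isInflated_res hQ) (h.hasInverseFactorSet_res hJG hQP)

omit [Finite A] h in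
lemma res_charMap [Fintype T.N] {K J : Subgroup A} (hKJ : K ≤ J) (hNK : T.N ≤ K) (χ : J → ℂ) :
    res (inf_le_inf_right S.G hKJ) (charMap P P' J χ) = charMap P P' K (res hKJ χ) := by
  ext y
  rw [charMap_apply, P.cofactor_res hKJ hNK χ y.2.1]
  rfl

omit [Finite A] h in
lemma charMap_mul [Fintype T.N] {J : Subgroup A} (hNJ : T.N ≤ J) (χ : J → ℂ) {β : J → ℂ}
    (hβ : β ∈ charQuot T.N J) :
    charMap P P' J (χ * β) = charMap P P' J χ * res inf_le_left β := by
  ext y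
  have h1 := P.cofactor_mul hNJ χ β (fun y x hx => charQuot_apply_mul hβ y x hx)
    (Subgroup.inclusion inf_le_left y)
  rw [charMap_apply, Pi.mul_apply, charMap_apply]
  refine (congrArg (· * _) h1).trans ?_
  exact mul_right_comm _ _ _

omit [Finite A] in
lemma conjSub_inf_le {J : Subgroup A} (hNJ : T.N ≤ J) {a γ : A} (hγ : γ ∈ S.G)
    (haγ : γ⁻¹ * a ∈ T.N) : conjSub a J ⊓ S.G ≤ conjSub γ (J ⊓ S.G) := by
  rintro y ⟨hy, hyS⟩
  refine mem_conjSub.2 ⟨?_, S.G.mul_mem (S.G.mul_mem hγ hyS) (S.G.inv_mem hγ)⟩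
  have hb : a * γ⁻¹ ∈ J := by
    have := T.conj_mem γ (h.le hγ) _ haγ
    refine hNJ ?_
    simpa using this
  have := J.mul_mem (J.mul_mem (J.inv_mem hb) (mem_conjSub.1 hy)) hb
  simpa [mul_assoc] using this

-- Strong isomorphisms require a and γ to agree only modulo N. Since aγ⁻¹ ∈ N ≤ J, a class function
-- on J does not see the difference; then the scalars acquired by tr(P⁻¹) and tr P' under
-- conjugation by γ are reciprocal and cancel.
omit [Finite A] in
lemma conjChar_charMap [Fintype T.N] {J : Subgroup A} (hNJ : T.N ≤ J)
    {a γ : A} (hγ : γ ∈ S.G) (haγ : γ⁻¹ * a ∈ T.N) {χ : J → ℂ} (hχ : χ ∈ charSet J) :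
    charMap P P' (conjSub a J) (conjChar a le_rfl χ) =
      conjChar γ (h.conjSub_inf_le hNJ hγ haγ) (charMap P P' J χ) := by
  ext y
  have hγG := h.le hγ
  have hyG := h.le y.2.2
  have hb : a * γ⁻¹ ∈ J := by
    have := T.conj_mem γ hγG _ haγ
    refine hNJ ?_
    simpa using this
  have h1 : ∀ z, extendZero (conjChar a (le_refl (conjSub a J)) χ) z =
      extendZero χ (γ * z * γ⁻¹) := fun z => by
    rw [extendZero_conjChar, ← extendZero_conj hχ hb (γ * z * γ⁻¹)]
    congr 1
    group
  let e : T.N ≃ T.N :=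
    { toFun := fun x => ⟨γ * x * γ⁻¹, T.conj_mem γ hγG x x.2⟩
      invFun := fun x => ⟨γ⁻¹ * x * γ, by
        simpa using T.conj_mem _ (inv_mem hγG) x x.2⟩
      left_inv := fun x => by ext; simp [mul_assoc]
      right_inv := fun x => by ext; simp [mul_assoc] }
  let γ' : S.G := ⟨γ, hγ⟩
  let y' : S.G := Subgroup.inclusion inf_le_right y
  change P.cofactor _ _ y * (P'.toFun y').val.trace =
    P.cofactor _ _ (γ * y * γ⁻¹) * (P'.toFun (γ' * y' * γ'⁻¹)).val.trace
  rw [cofactor_apply, cofactor_apply, mul_assoc, mul_assoc, Finset.sum_mul, Finset.sum_mul]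
  congr 1
  refine Fintype.sum_equiv e _ _ fun x => ?_
  have h2 : γ * (y : A) * γ⁻¹ * e x = γ * (y * x) * γ⁻¹ := by simp [e, mul_assoc]
  rw [h2, h1]
  refine (mul_assoc _ _ _).trans (Eq.trans ?_ (mul_assoc _ _ _).symm)
  congr 1
  let g : T.G := ⟨γ, hγG⟩
  let z : T.G := ⟨y, hyG⟩
  let w : T.G := ⟨y * x, T.G.mul_mem hyG (T.N_le x.2)⟩
  have e0 : extendZero (fun g => (P.toFun g)⁻¹.val.trace) (γ * (y * x) * γ⁻¹) =
      (P.toFun (g * w * g⁻¹))⁻¹.val.trace := extendZero_of_mem _ (g * w * g⁻¹).2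
  rw [extendZero_of_mem _ w.2, e0]
  change (P.toFun w)⁻¹.val.trace * _ = (P.toFun (g * w * g⁻¹))⁻¹.val.trace * _
  have e1 := P'.trace_conj γ' y'
  have e2 := P.trace_inv_conj g w
  have hzw : (z : A)⁻¹ * w ∈ T.N := by simp [z, w]
  have hzw' : ((g * z * g⁻¹ : T.G) : A)⁻¹ * (g * w * g⁻¹ : T.G) ∈ T.N := by
    have := T.conj_mem γ hγG x x.2
    simpa [g, z, w, mul_assoc] using this
  rw [h.assoc.factorSet_congr (x := g * z * g⁻¹) (y := g) hzw' (by simp),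
    h.assoc.factorSet_congr (x := g) (y := z) (by simp) hzw] at e2
  have e3 : P.factorSet g z = P'.factorSet γ' y' := h.factorSet_eq γ' y'
  have e4 : P.factorSet (g * z * g⁻¹) g = P'.factorSet (γ' * y' * γ'⁻¹) γ' :=
    h.factorSet_eq (γ' * y' * γ'⁻¹) γ'
  rw [e3, e4] at e2
  refine mul_left_cancel₀ (P'.factorSet γ' y').ne_zero ?_
  linear_combination -(P'.toFun y').val.trace * e2 -
    (P.toFun (g * w * g⁻¹))⁻¹.val.trace * e1

omit [Finite A] in
lemma exists_rep {J : Subgroup A} (hJ : J ≤ T.N ⊔ (J ⊓ S.G)) (x : J) :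
    ∃ y : ↥(J ⊓ S.G), (x : A)⁻¹ * y ∈ T.N := by
  obtain ⟨k, hk, hxk⟩ := exists_inv_mul_mem_of_mem_sup
    (fun k (hk : k ∈ J ⊓ S.G) x hx => T.conj_mem k (h.le hk.2) x hx) (hJ x.2)
  exact ⟨⟨k, hk⟩, hxk⟩

-- Dedekind's modular law: an element of J ≤ NH differs by N ≤ J from an element of H, which
-- therefore lies in J.
omit [Finite A] in
lemma le_sup_inf {J : Subgroup A} (hNJ : T.N ≤ J) (hJ : J ≤ T.N ⊔ S.G) :
    J ≤ T.N ⊔ (J ⊓ S.G) := by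
  intro x hx
  obtain ⟨k, hk, hxk⟩ := exists_inv_mul_mem_of_mem_sup
    (fun k hk x hx => T.conj_mem k (h.le hk) x hx) (hJ hx)
  have hkJ : k ∈ J := by simpa using J.mul_mem hx (hNJ hxk)
  have h1 := T.conj_mem k (h.le hk) _ (T.N.inv_mem hxk)
  have h2 : x = (k * ((x⁻¹ * k)⁻¹) * k⁻¹) * k := by group
  rw [h2]
  exact Subgroup.mul_mem_sup h1 ⟨hkJ, hk⟩

omit [Finite A] in
/-- Extension of a projective representation of `(J ∩ H) / M` to `J / N` if `J = N (J ∩ H)`. -/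
lemma exists_extension {J : Subgroup A} (hJG : J ≤ T.G)
    (hJ : J ≤ T.N ⊔ (J ⊓ S.G)) {Q' : ProjRep ↥(J ⊓ S.G) m} (hQ' : Q'.IsInflated S.N)
    (hQP' : Q'.HasInverseFactorSet (P'.res inf_le_right)) :
    ∃ Q : ProjRep J m, Q.IsInflated T.N ∧ Q.HasInverseFactorSet (P.res hJG) ∧
      ∀ y : ↥(J ⊓ S.G), Q.toFun (Subgroup.inclusion inf_le_left y) = Q'.toFun y := by
  -- Q is defined through coset representatives in J ∩ H; since N ∩ H = M, the choice does not
  -- affect the value of Q'.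
  choose s hs using h.exists_rep hJ
  have hcongr : ∀ (x : J) (y y' : ↥(J ⊓ S.G)), (x : A)⁻¹ * y ∈ T.N → (x : A)⁻¹ * y' ∈ T.N →
      Q'.toFun y = Q'.toFun y' := fun x y y' hy hy' => by
    refine hQ' _ _ ((h.mem_N_iff (S.G.mul_mem (S.G.inv_mem y.2.2) y'.2.2)).2 ?_)
    simpa [mul_assoc] using T.N.mul_mem (T.N.inv_mem hy) hy'
  refine ⟨⟨fun x => Q'.toFun (s x), fun x y => ((P.res hJG).factorSet x y)⁻¹, Q'.pos,
    fun x y => ?_⟩, fun x y hxy => ?_, fun _ _ => rfl, fun y => ?_⟩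
  · have h1 : Q'.factorSet (s x) (s y) = ((P.res hJG).factorSet x y)⁻¹ := by
      rw [hQP']
      congr 1
      refine (h.factorSet_eq (Subgroup.inclusion inf_le_right (s x))
        (Subgroup.inclusion inf_le_right (s y))).symm.trans ?_
      exact h.assoc.factorSet_congr (x := Subgroup.inclusion hJG x)
        (y := Subgroup.inclusion hJG y) (hs x) (hs y)
    rw [Q'.mul_eq, h1]
    congr 2
    refine hcongr (x * y) _ _ ?_ (hs _)
    have h2 := T.conj_mem _ (T.G.inv_mem (hJG y.2)) _ (hs x)
    have h3 := T.N.mul_mem h2 (hs y)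
    simpa [mul_assoc] using h3
  · refine hcongr x _ _ (hs x) ?_
    simpa [mul_assoc] using T.N.mul_mem hxy (hs y)
  · exact hcongr (Subgroup.inclusion inf_le_left y) _ _ (hs _) (by simp)

/-- Injectivity: the cofactor of P' recovers tr Q on J ∩ H, which meets every coset of N in J.
Surjectivity: `exists_extension` lifts the projective representation belonging to a character over
φ. -/
theorem bijOn_charMap [Fintype T.N] {J : Subgroup A} (hNJ : T.N ≤ J) (hJG : J ≤ T.G)
    (hJ : J ≤ T.N ⊔ (J ⊓ S.G)) :
    Set.BijOn (charMap P P' J) (charOver J T.θ) (charOver (J ⊓ S.G) S.θ) := by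
  have := Fintype.ofFinite S.N
  refine ⟨h.mapsTo_charMap hNJ hJG, ?_, ?_⟩
  · intro χ hχ ψ hψ heq
    obtain ⟨m, Q, hQ, hQP, rfl⟩ := h.assoc.exists_eq_tensorTrace_res hNJ hJG hχ
    obtain ⟨k, R, hR, hRP, rfl⟩ := h.assoc.exists_eq_tensorTrace_res hNJ hJG hψ
    rw [h.charMap_tensorTrace hNJ hJG hQ, h.charMap_tensorTrace hNJ hJG hR] at heq
    have hcof := fun {l : ℕ} {W : ProjRep J l} (hW : W.IsInflated T.N) =>
      h.assoc'.cofactor_tensorTrace (h.N_le_inf hNJ) inf_le_right (h.isInflated_res hW)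
    ext x
    obtain ⟨y, hy⟩ := h.exists_rep hJ x
    have h1 : (Q.toFun (Subgroup.inclusion inf_le_left y)).val.trace =
        (R.toFun (Subgroup.inclusion inf_le_left y)).val.trace :=
      (hcof hQ y).symm.trans ((congrArg (fun f => P'.cofactor _ f y) heq).trans (hcof hR y))
    rw [tensorTrace_apply, tensorTrace_apply, hQ x (Subgroup.inclusion inf_le_left y) hy,
      hR x (Subgroup.inclusion inf_le_left y) hy, h1]
  · intro ψ hψ
    obtain ⟨m, Q', hQ', hQP', rfl⟩ :=
      h.assoc'.exists_eq_tensorTrace_res (h.N_le_inf hNJ) inf_le_right hψ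
    obtain ⟨Q, hQ, hQP, hQQ'⟩ := h.exists_extension hJG hJ hQ' hQP'
    refine ⟨Q.tensorTrace (P.res hJG),
      (h.assoc.restrict hNJ hJG).tensorTrace_mem_charOver hQ hQP, ?_⟩
    rw [h.charMap_tensorTrace hNJ hJG hQ]
    ext y
    rw [tensorTrace_apply, tensorTrace_apply, ← hQQ' y]
    rfl

/-- By `innerProd_tensorTrace` both sides average the same function on J/N, once over J and once
over J ∩ H, and J ∩ H covers J/N. -/
theorem innerProd_charMap [Fintype T.N] {J : Subgroup A} (hNJ : T.N ≤ J) (hJG : J ≤ T.G)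
    (hJ : J ≤ T.N ⊔ (J ⊓ S.G)) {χ ψ : J → ℂ} (hχ : χ ∈ charOver J T.θ)
    (hψ : ψ ∈ charOver J T.θ) :
    innerProd χ ψ = innerProd (charMap P P' J χ) (charMap P P' J ψ) := by
  have := Fintype.ofFinite J
  have := Fintype.ofFinite ↥(J ⊓ S.G)
  obtain ⟨m, Q, hQ, hQP, rfl⟩ := h.assoc.exists_eq_tensorTrace_res hNJ hJG hχ
  obtain ⟨k, R, hR, hRP, rfl⟩ := h.assoc.exists_eq_tensorTrace_res hNJ hJG hψ
  rw [h.charMap_tensorTrace hNJ hJG hQ, h.charMap_tensorTrace hNJ hJG hR]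
  have hPJ := h.assoc.restrict hNJ hJG
  have hPJ' := h.assoc'.restrict (h.N_le_inf hNJ) (inf_le_right : J ⊓ S.G ≤ S.G)
  let _ : Fintype (T.restrict J hNJ hJG).G := ‹Fintype J›
  let _ : Fintype (S.restrict (J ⊓ S.G) (h.N_le_inf hNJ) inf_le_right).G :=
    ‹Fintype ↥(J ⊓ S.G)›
  refine (hPJ.innerProd_tensorTrace hQ hR hRP).trans (Eq.trans ?_ (hPJ'.innerProd_tensorTrace
    (h.isInflated_res hQ) (h.isInflated_res hR) (h.hasInverseFactorSet_res hJG hRP)).symm)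
  refine ((T.restrict J hNJ hJG).average_eq_of_forall_exists (K := ↥(J ⊓ S.G))
    (Subgroup.inclusion inf_le_left)
    (h.exists_rep hJ) _ fun g g' hg => hPJ.trace_mul_factorSet_congr hQ hR hg).trans ?_
  refine congrArg (_ * ·) (Finset.sum_congr rfl fun y _ => ?_)
  have h3 := h.factorSet_eq (Subgroup.inclusion inf_le_right y)
    (Subgroup.inclusion inf_le_right y)⁻¹
  exact congrArg (fun u : ℂˣ => _ * (u : ℂ)) h3

end GivesRel

end CharacterMap

/-! ### Irreducible characters over an extendible θ with abelian quotient. -/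

section Gallagher

open ProjRep

section CommutingRepresentations

variable {G : Type*} [Group G] [Finite G] {m : ℕ}

/-- A representation by commuting matrices contains a linear character. -/
lemma exists_monoidHom_innerProd_ne_zero (hm : 0 < m) (R : G →* Matrix (Fin m) (Fin m) ℂ)
    (hR : ∀ g h, R g * R h = R h * R g) :
    ∃ l : G →* ℂˣ, (∀ g, R g = 1 → l g = 1) ∧
      innerProd (fun g => (R g).trace) (fun g => (l g : ℂ)) ≠ 0 := by
  have : NeZero m := ⟨hm.ne'⟩
  obtain ⟨k, σ, f, hσ, hf⟩ := exists_irreducible_injective _ (matRep R) le_rfl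
  have hfσ : ∀ g v, f (σ g v) = matRep R g (f v) := fun g v =>
    IntertwiningMap.isIntertwining _ _ f g v
  have := nontrivial_of_isIrreducible σ
  have hscalar : ∀ g, ∃ c : ℂ, ∀ v, σ g v = c • v := fun g => by
    obtain ⟨c, hc⟩ := (IsIrreducible.algebraMap_intertwiningMap_bijective_of_isAlgClosed
      (ρ := σ)).2 ⟨σ g, fun x => LinearMap.ext fun v => hf (by
        simp only [LinearMap.comp_apply, hfσ, matRep_apply]
        rw [← LinearMap.comp_apply, ← Matrix.toLin'_mul, hR, Matrix.toLin'_mul,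
          LinearMap.comp_apply])⟩
    exact ⟨c, fun v => (congrArg (fun F : IntertwiningMap σ σ => F v) hc).symm⟩
  choose c hc using hscalar
  -- All σ(g) are scalar, so any nonzero vector spans an invariant line; l is read off there without
  -- showing that σ has degree one.
  obtain ⟨v, hv⟩ := exists_ne (0 : Fin k → ℂ)
  have hinj : ∀ a b : ℂ, a • v = b • v → a = b := fun a b hab => smul_left_injective ℂ hv hab
  let l₀ : G →* ℂ :=
    { toFun := c
      map_one' := hinj _ _ (by rw [← hc, map_one]; simp)
      map_mul' := fun g h => hinj _ _ (by
        rw [← hc, map_mul, Module.End.mul_apply, hc h, map_smul, hc g, smul_smul, mul_comm]) }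
  have hR1 : ∀ g, matRep R g (f v) = c g • f v := fun g => by rw [← hfσ, hc, map_smul]
  have hfv : f v ≠ 0 := fun h => hv (hf (by rw [h, map_zero]))
  refine ⟨l₀.toHomUnits, fun g hg => Units.ext (hinj _ _ (hf ?_)), ?_⟩
  · change f (c g • v) = f ((1 : ℂ) • v)
    rw [map_smul, ← hR1, matRep_apply, hg, one_smul, Matrix.toLin'_one, LinearMap.id_apply]
  · let L : Representation ℂ G ℂ :=
      { toFun := fun g => c g • LinearMap.id
        map_one' := by
          have : c 1 = 1 := l₀.map_one
          rw [this, one_smul]; rfl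
        map_mul' := fun g h => by
          have : c (g * h) = c g * c h := l₀.map_mul g h
          ext; simp [this, mul_comm] }
    have hL : L.character = fun g => ((l₀.toHomUnits g : ℂˣ) : ℂ) := by
      ext g
      change LinearMap.trace ℂ ℂ (c g • LinearMap.id) = c g
      simp
    have hRc : (matRep R).character = fun g => (R g).trace := funext (character_matRep R)
    rw [← hL, ← hRc]
    refine innerProd_ne_zero_of_ne_zero (ρ := L)
      ⟨LinearMap.toSpanSingleton ℂ _ (f v), fun g => ?_⟩ fun h => hfv ?_
    · ext : 1
      change (c g • (1 : ℂ)) • f v = matRep R g ((1 : ℂ) • f v)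
      rw [one_smul, hR1, smul_eq_mul, mul_one]
    · have := congrArg (fun F : IntertwiningMap L (matRep R) => F (1 : ℂ)) h
      exact (one_smul ℂ (f v)).symm.trans this

end CommutingRepresentations

section IrreducibleOver

variable {A : Type*} [Group A] [Finite A]

lemma irrOver_subset_charOver {N J : Subgroup A} (θ : N → ℂ) : irrOver J θ ⊆ charOver J θ :=
  fun _ h => ⟨irr_subset_charSet h.1, fun _ hξ => eq_of_mem_irr h.1 hξ.1 hξ.2 ▸ h⟩

lemma mem_irrOver_of_mem_charOver {N J : Subgroup A} {θ : N → ℂ} {χ : J → ℂ}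
    (h : χ ∈ charOver J θ) (hχ : χ ∈ irr J) : χ ∈ irrOver J θ :=
  h.2 χ ⟨hχ, by rw [innerProd_self_of_mem_irr hχ]; exact one_ne_zero⟩

end IrreducibleOver

namespace ProjRep

section Twist

variable {G : Type*} [Group G] {m n : ℕ}

/-- The product of a projective representation and a linear character. -/
def twist (Q : ProjRep G m) (l : G →* ℂˣ) : ProjRep G m where
  toFun g := Units.map (Matrix.scalar (Fin m)).toMonoidHom (l g) * Q.toFun g
  factorSet := Q.factorSet
  pos := Q.pos
  mul_eq g h := by
    have hs : ∀ (c : ℂˣ) (X : Matrix (Fin m) (Fin m) ℂ),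
        (Units.map (Matrix.scalar (Fin m)).toMonoidHom c).val * X = (c : ℂ) • X := fun c X =>
      (Matrix.smul_eq_diagonal_mul X _).symm
    simp only [Units.val_mul, hs, map_mul, smul_mul_assoc, mul_smul_comm, Q.mul_eq, smul_smul]
    congr 1
    ring

lemma twist_toFun_val (Q : ProjRep G m) (l : G →* ℂˣ) (g : G) :
    ((Q.twist l).toFun g).val = (l g : ℂ) • (Q.toFun g).val :=
  (Matrix.smul_eq_diagonal_mul _ _).symm

/-- The scalar by which a projective representation of degree one acts. -/
lemma trace_mul_trace (Q : ProjRep G 1) (g h : G) :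
    (Q.toFun g).val.trace * (Q.toFun h).val.trace =
      Q.factorSet g h * (Q.toFun (g * h)).val.trace := by
  have := congrFun (congrFun (Q.mul_eq g h) 0) 0
  simpa [Matrix.mul_apply, Matrix.trace] using this

lemma trace_ne_zero (Q : ProjRep G 1) (g : G) : (Q.toFun g).val.trace ≠ 0 := by
  have h := (Matrix.isUnit_iff_isUnit_det _).1 (Q.toFun g).isUnit
  rw [Matrix.det_fin_one] at h
  simpa [Matrix.trace] using h.ne_zero

end Twist

variable {A : Type*} [Group A] {n m : ℕ}

lemma IsInflated.twist {N J : Subgroup A} {Q : ProjRep J m} (hQ : Q.IsInflated N) {l : J →* ℂˣ}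
    (hl : ∀ x : J, (x : A) ∈ N → l x = 1) : (Q.twist l).IsInflated N := fun x y hxy => by
  have h1 : l x = l y := by
    rw [← inv_mul_eq_one, ← map_inv, ← map_mul]
    exact hl _ hxy
  refine Units.ext ?_
  rw [twist_toFun_val, twist_toFun_val, h1, hQ x y hxy]

namespace IsAssociated

variable [Finite A] {T : CharTriple A} {P : ProjRep T.G n} (hP : P.IsAssociated T)

include hP

/-- A projective representation of degree one yields extensions of `θ`. -/
lemma tensorTrace_mem_irrOver {Q : ProjRep T.G 1} (hQ : Q.IsInflated T.N)
    (hQP : Q.HasInverseFactorSet P) : Q.tensorTrace P ∈ irrOver T.G T.θ := by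
  have h1 := hP.tensorTrace_mem_charOver hQ hQP
  refine mem_irrOver_of_mem_charOver h1 (mem_irr_of_comp_mem_irr (Subgroup.inclusion T.N_le)
    h1.1 ?_)
  convert T.θ_irr using 1
  ext x
  rw [tensorTrace_apply, ← hP.affords, ← hQ 1 (Subgroup.inclusion T.N_le x) (by simp),
    hP.toFun_one_of_hasInverseFactorSet hQP]
  simp

/-- If `θ` extends to `G` and `G / N` is abelian, the irreducible characters over `θ` are
extensions of `θ` that differ by linear characters. -/
lemma exists_eq_twist_tensorTrace (hab : ∀ g h : T.G, (((g * h)⁻¹ * (h * g) : T.G) : A) ∈ T.N)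
    {Q : ProjRep T.G 1} (hQ : Q.IsInflated T.N) (hQP : Q.HasInverseFactorSet P)
    {ψ : T.G → ℂ} (hψ : ψ ∈ irrOver T.G T.θ) :
    ∃ l : T.G →* ℂˣ, (∀ x : T.G, (x : A) ∈ T.N → l x = 1) ∧
      ψ = (Q.twist l).tensorTrace P := by
  have := Fintype.ofFinite T.G
  obtain ⟨m, W, hW, hWP, rfl⟩ := hP.exists_eq_tensorTrace (irrOver_subset_charOver _ hψ)
  let q : T.G → ℂ := fun g => (Q.toFun g).val.trace
  have hq : ∀ g, q g ≠ 0 := Q.trace_ne_zero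
  have hqmul : ∀ g h, q g * q h * P.factorSet g h = q (g * h) := fun g h => by
    rw [Q.trace_mul_trace, hQP, mul_right_comm, ← Units.val_mul, inv_mul_cancel, Units.val_one,
      one_mul]
  have hq1 : q 1 = 1 := by
    simp only [q, hP.toFun_one_of_hasInverseFactorSet hQP]
    simp
  -- W and Q have the same factor set α⁻¹, so dividing W by the scalars of Q gives a linear
  -- representation of the abelian group G/N.
  let R : T.G →* Matrix (Fin m) (Fin m) ℂ :=
    { toFun := fun g => (q g)⁻¹ • (W.toFun g).val
      map_one' := by rw [hq1, hP.toFun_one_of_hasInverseFactorSet hWP]; simp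
      map_mul' := fun g h => by
        rw [smul_mul_assoc, mul_smul_comm, W.mul_eq, hWP, smul_smul, smul_smul, ← hqmul,
          Units.val_inv_eq_inv_val]
        congr 1
        rw [mul_inv, mul_inv, mul_assoc] }
  have hR1 : ∀ x : T.G, (x : A) ∈ T.N → R x = 1 := fun x hx => by
    rw [← _root_.map_one R]
    change (q x)⁻¹ • (W.toFun x).val = (q 1)⁻¹ • (W.toFun 1).val
    have hx' : (((1 : T.G) : A))⁻¹ * x ∈ T.N := by simpa using hx
    simp only [q]
    rw [hQ 1 x hx', hW 1 x hx']
  have hRcomm : ∀ g h, R g * R h = R h * R g := fun g h => by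
    have h1 := hR1 ((g * h)⁻¹ * (h * g)) (hab g h)
    have h2 : h * g = g * h * ((g * h)⁻¹ * (h * g)) := by group
    rw [← _root_.map_mul R, ← _root_.map_mul R, h2, _root_.map_mul R (g * h), h1, mul_one]
  obtain ⟨l, hl, hne⟩ := exists_monoidHom_innerProd_ne_zero W.pos R hRcomm
  have hlN : ∀ x : T.G, (x : A) ∈ T.N → l x = 1 := fun x hx => hl x (hR1 x hx)
  refine ⟨l, hlN, ?_⟩
  have hQl := hQ.twist hlN
  refine (eq_of_mem_irr hψ.1 (hP.tensorTrace_mem_irrOver hQl hQP).1 ?_).symm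
  -- With P eliminated, this inner product is that of tr R with l, which is nonzero.
  rw [hP.innerProd_tensorTrace hW hQl hQP]
  have hlchar : (fun g => (l g : ℂ)) ∈ charSet T.G := by
    refine ⟨1, matRep ((Matrix.scalar (Fin 1)).toMonoidHom.comp ((Units.coeHom ℂ).comp l)),
      one_pos, ?_⟩
    ext g
    rw [character_matRep]
    simp [Matrix.trace]
  rw [innerProd_eq_sum _ hlchar] at hne
  convert hne using 2
  refine Finset.sum_congr rfl fun g _ => ?_
  change _ = ((q g)⁻¹ • (W.toFun g).val).trace * _
  rw [twist_toFun_val, Matrix.trace_smul, Matrix.trace_smul, smul_eq_mul, smul_eq_mul]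
  have h3 := hqmul g g⁻¹
  rw [mul_inv_cancel, hq1] at h3
  have h4 : (q g)⁻¹ = q g⁻¹ * P.factorSet g g⁻¹ :=
    inv_eq_of_mul_eq_one_right (by rw [← mul_assoc, h3])
  rw [h4]
  ring

end IsAssociated

end ProjRep

/-- Linear characters of `L / (N ∩ L)` extend to `J / N` if this group is abelian. -/
lemma exists_monoidHom_extension {A : Type*} [Group A] [Finite A] {N J L : Subgroup A}
    (hab : ⁅J, J⁆ ≤ N) (hLJ : L ≤ J) (l : L →* ℂˣ)
    (hl : ∀ x : L, (x : A) ∈ N → l x = 1) :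
    ∃ l' : J →* ℂˣ, (∀ x : J, (x : A) ∈ N → l' x = 1) ∧
      ∀ x : L, l' (Subgroup.inclusion hLJ x) = l x := by
  have hn : (N.subgroupOf J).Normal := by
    refine ⟨fun x hx g => ?_⟩
    have h1 := hab (Subgroup.commutator_mem_commutator g.2 x.2)
    rw [Subgroup.mem_subgroupOf] at hx ⊢
    have := N.mul_mem h1 hx
    simpa [commutatorElement_def] using this
  let Q := J ⧸ N.subgroupOf J
  let _ : CommGroup Q :=
    { (inferInstance : Group Q) with
      mul_comm := by
        rintro ⟨a⟩ ⟨b⟩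
        refine QuotientGroup.eq.2 ?_
        rw [Subgroup.mem_subgroupOf]
        have h1 :=
          hab (Subgroup.commutator_mem_commutator (J.inv_mem b.2) (J.inv_mem a.2))
        simpa [commutatorElement_def, mul_assoc] using h1 }
  let π : J →* Q := QuotientGroup.mk' _
  have hπ : ∀ x : J, π x = 1 ↔ (x : A) ∈ N := fun x =>
    (QuotientGroup.eq_one_iff x).trans Subgroup.mem_subgroupOf
  let ι := π.comp (Subgroup.inclusion hLJ)
  have hker : ι.ker ≤ l.ker := fun x hx => by
    rw [MonoidHom.mem_ker] at hx ⊢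
    exact hl x ((hπ _).1 hx)
  -- l descends to the image of L in J/N, and from there extends to the whole finite abelian group.
  let l₁ : ι.range →* ℂˣ := (QuotientGroup.lift ι.ker l hker).comp
    (QuotientGroup.quotientKerEquivRange ι).symm.toMonoidHom
  obtain ⟨l₂, hl₂⟩ := MonoidHom.domRestrict_surjective (M := ℂ) ι.range l₁
  refine ⟨l₂.comp π, fun x hx => ?_, fun x => ?_⟩
  · rw [MonoidHom.comp_apply, (hπ x).2 hx, map_one]
  · have h1 := congrArg (fun F => F (ι.rangeRestrict x)) hl₂
    refine Eq.trans h1 ?_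
    have h2 : (QuotientGroup.quotientKerEquivRange ι).symm (ι.rangeRestrict x) =
        (x : L ⧸ ι.ker) := (MulEquiv.symm_apply_eq _).2 rfl
    change QuotientGroup.lift ι.ker l hker ((QuotientGroup.quotientKerEquivRange ι).symm _) = _
    rw [h2]
    rfl

end Gallagher

/-! ### The strong isomorphism and the theorem. -/

section MainResults

open ProjRep

variable {A : Type*} [Group A] {n n' m : ℕ} {T S : CharTriple A} {P : ProjRep T.G n}
  {P' : ProjRep S.G n'}

/-- A one-dimensional projective representation attached to an extension of `θ`. -/
lemma ProjRep.IsAssociated.exists_projRep_one [Finite A] (hP : P.IsAssociated T)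
    {J : Subgroup A} (hNJ : T.N ≤ J) (hJG : J ≤ T.G) {χ : J → ℂ} (hχ : χ ∈ charSet J)
    (hχθ : CharTriples.res hNJ χ = T.θ) :
    ∃ Q : ProjRep J 1, Q.IsInflated T.N ∧ Q.HasInverseFactorSet (P.res hJG) := by
  have h1 : χ ∈ charOver J T.θ := (hP.mem_charOver_iff hNJ hJG).2
    ⟨hχ, 1, fun x => by rw [one_mul, ← hχθ]; rfl⟩
  obtain ⟨m, Q, hQ, hQP, rfl⟩ := hP.exists_eq_tensorTrace_res hNJ hJG h1
  -- Comparing degrees at 1 gives n = mn, so m = 1.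
  have h2 := congrFun hχθ 1
  have h3 := hP.affords 1
  rw [← h2, _root_.map_one, hP.map_one] at h3
  change _ = Q.tensorTrace (P.res hJG) 1 at h3
  have hP1 : (P.res hJG).toFun 1 = 1 := hP.map_one
  have hQ1 : Q.toFun 1 = 1 := (hP.restrict hNJ hJG).toFun_one_of_hasInverseFactorSet hQP
  rw [tensorTrace_apply, hP1, hQ1, Units.val_one, Units.val_one, Matrix.trace_one,
    Matrix.trace_one, Fintype.card_fin, Fintype.card_fin] at h3
  have hn : (n : ℂ) ≠ 0 := by exact_mod_cast P.pos.ne'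
  have h4 : (m : ℂ) = 1 := mul_right_cancel₀ hn (by rw [← h3, one_mul])
  obtain rfl : m = 1 := by exact_mod_cast h4
  exact ⟨Q, hQ, hQP⟩

namespace GivesRel

variable (h : GivesRel T S P P')

include h

/-- The canonical isomorphism `N H / N ≃ H / M`. -/
lemma exists_quotEquiv :
    ∃ τ : (T.restrict (T.N ⊔ S.G) le_sup_left (sup_le T.N_le h.le)).Quot ≃* S.Quot,
      ∀ x : S.G, τ ((T.restrict (T.N ⊔ S.G) le_sup_left (sup_le T.N_le h.le)).proj
        (Subgroup.inclusion le_sup_right x)) = S.proj x := by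
  set T' := T.restrict (T.N ⊔ S.G) le_sup_left (sup_le T.N_le h.le) with hT'
  let ι : S.G →* T'.G := Subgroup.inclusion le_sup_right
  let f : S.G →* T'.Quot := T'.proj.comp ι
  have hf : Function.Surjective f := by
    intro q
    obtain ⟨x, rfl⟩ : ∃ x, T'.proj x = q := QuotientGroup.mk'_surjective _ q
    obtain ⟨k, hk, hxk⟩ := exists_inv_mul_mem_of_mem_sup
      (fun k hk x hx => T.conj_mem k (h.le hk) x hx) x.2
    exact ⟨⟨k, hk⟩, ((T'.proj_eq_proj_iff (g := x) (g' := ι ⟨k, hk⟩)).2 hxk).symm⟩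
  have hker : S.N.subgroupOf S.G = f.ker := by
    ext x
    rw [Subgroup.mem_subgroupOf, MonoidHom.mem_ker, h.mem_N_iff x.2, ← map_one f, eq_comm]
    refine Iff.trans ?_ T'.proj_eq_proj_iff.symm
    have h1 : ((ι 1 : T'.G) : A)⁻¹ * (ι x : T'.G) = x := by
      rw [map_one, OneMemClass.coe_one, inv_one, one_mul]
      rfl
    rw [h1]
    rfl
  let e : S.Quot ≃* T'.Quot := (QuotientGroup.quotientMulEquivOfEq hker).trans
    (QuotientGroup.quotientKerEquivOfSurjective f hf)
  exact ⟨e.symm, fun x => (MulEquiv.symm_apply_eq e).2 rfl⟩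

variable [Finite A]

theorem isStrongIso_charMap [Fintype T.N]
    (τ : (T.restrict (T.N ⊔ S.G) le_sup_left (sup_le T.N_le h.le)).Quot ≃* S.Quot)
    (hτ : ∀ x : S.G, τ ((T.restrict (T.N ⊔ S.G) le_sup_left (sup_le T.N_le h.le)).proj
      (Subgroup.inclusion le_sup_right x)) = S.proj x) :
    (T.restrict (T.N ⊔ S.G) le_sup_left (sup_le T.N_le h.le)).IsStrongIso S τ
      (fun J => J ⊓ S.G) (fun J => charMap P P' J) := by
  have hNH : T.N ⊔ S.G ≤ T.G := sup_le T.N_le h.le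
  -- All uses of τ go through this: corresponding elements are those in a common coset of N.
  have hτ' : ∀ (x : (T.restrict (T.N ⊔ S.G) le_sup_left hNH).G) (y : S.G),
      τ ((T.restrict (T.N ⊔ S.G) le_sup_left hNH).proj x) = S.proj y ↔ (y : A)⁻¹ * x ∈ T.N := by
    intro x y
    rw [← hτ, τ.injective.eq_iff, eq_comm]
    exact CharTriple.proj_eq_proj_iff _
  refine ⟨fun J _ _ => inf_le_right, fun J hNJ hJ y => ?_,
    fun J hNJ hJ => h.mapsTo_charMap hNJ (hJ.trans hNH), fun J hNJ hJ χ hχ ψ hψ =>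
      ⟨h.assoc.add_mem_charOver hNJ (hJ.trans hNH) hχ hψ, map_add _ _ _⟩,
    fun J hNJ hJ χ hχ ψ hψ => h.innerProd_charMap hNJ (hJ.trans hNH) (h.le_sup_inf hNJ hJ) hχ hψ,
    fun K J hKJ hNK hJ => ⟨inf_le_inf_right _ hKJ, fun χ hχ =>
      ⟨h.assoc.res_mem_charOver hKJ hNK (hJ.trans hNH) hχ, (res_charMap (T := T) hKJ hNK χ).symm⟩⟩,
    fun J hNJ hJ χ hχ β hβ => ⟨h.assoc.mul_mem_charOver hNJ (hJ.trans hNH) hχ hβ,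
      fun x y hx hy hxy => ?_⟩,
    fun J hNJ hJ g γ hg => ⟨T.le_conjSub hNJ (hNH g.2),
      (T.restrict (T.N ⊔ S.G) le_sup_left hNH).conjSub_le hJ g.2,
      h.conjSub_inf_le hNJ γ.2 ((hτ' g γ).1 hg), fun χ hχ =>
      ⟨h.assoc.conjChar_mem_charOver hNJ (hJ.trans hNH) (hNH g.2) hχ,
        h.conjChar_charMap hNJ γ.2 ((hτ' g γ).1 hg) hχ.1⟩⟩⟩
  · constructor
    · intro hy
      exact ⟨Subgroup.inclusion le_sup_right y, hy.1, hτ y⟩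
    · rintro ⟨x, hx, hxy⟩
      have h1 := hNJ (T.N.inv_mem ((hτ' x y).1 hxy))
      refine ⟨?_, y.2⟩
      simpa using J.mul_mem hx h1
  · rw [charMap_mul (T := T) hNJ χ hβ, Pi.mul_apply]
    congr 1
    have h1 := charQuot_apply_mul hβ ⟨y, hy.1⟩ ⟨_, hNJ ((hτ' x y).1 hxy)⟩ ((hτ' x y).1 hxy)
    refine h1.symm.trans (congrArg β ?_)
    ext
    simp

/-- The degree-one Q and its restriction to J ∩ H parametrize both sets by twists with linear
characters; the map restricts these characters, and restriction is onto by
`exists_monoidHom_extension`. -/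
theorem charMap_irrOver [Fintype T.N] {J : Subgroup A} (hNJ : T.N ≤ J) (hJG : J ≤ T.G)
    (hab : ⁅J, J⁆ ≤ T.N) (hext : ∃ χ ∈ charSet J, res hNJ χ = T.θ) :
    Set.MapsTo (charMap P P' J) (irrOver J T.θ) (irrOver (J ⊓ S.G) S.θ) ∧
      Set.SurjOn (charMap P P' J) (irrOver J T.θ) (irrOver (J ⊓ S.G) S.θ) := by
  obtain ⟨χ, hχ, hχθ⟩ := hext
  obtain ⟨Q, hQ, hQP⟩ := h.assoc.exists_projRep_one hNJ hJG hχ hχθ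
  have hPJ := h.assoc.restrict hNJ hJG
  have hPJ' := h.assoc'.restrict (h.N_le_inf hNJ) (inf_le_right : J ⊓ S.G ≤ S.G)
  have hcomm : ∀ a ∈ J, ∀ b ∈ J, (a * b)⁻¹ * (b * a) ∈ T.N := fun a ha b hb => by
    have := hab (Subgroup.commutator_mem_commutator (J.inv_mem hb) (J.inv_mem ha))
    simpa [commutatorElement_def, mul_assoc] using this
  constructor
  · intro ψ hψ
    obtain ⟨l, hl, rfl⟩ := hPJ.exists_eq_twist_tensorTrace
      (fun a b => hcomm a a.2 b b.2) hQ hQP hψ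
    have hQl := hQ.twist hl
    have h1 := h.charMap_tensorTrace hNJ hJG hQl
    change charMap P P' J ((Q.twist l).tensorTrace (P.res hJG)) ∈ _
    rw [h1]
    exact hPJ'.tensorTrace_mem_irrOver (h.isInflated_res hQl)
      (h.hasInverseFactorSet_res hJG hQP)
  · intro ψ hψ
    obtain ⟨l, hl, rfl⟩ := hPJ'.exists_eq_twist_tensorTrace
      (fun a b => (h.mem_N_iff (((a * b)⁻¹ * (b * a) :
        ↥(J ⊓ S.G)).2.2)).2 (hcomm a a.2.1 b b.2.1)) (h.isInflated_res hQ)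
      (h.hasInverseFactorSet_res hJG hQP) hψ
    obtain ⟨l', hl', hll'⟩ := exists_monoidHom_extension hab (inf_le_left : J ⊓ S.G ≤ J) l
      fun x hx => hl x ((h.mem_N_iff x.2.2).2 hx)
    have hQl := hQ.twist hl'
    refine ⟨(Q.twist l').tensorTrace (P.res hJG), hPJ.tensorTrace_mem_irrOver hQl hQP, ?_⟩
    rw [h.charMap_tensorTrace hNJ hJG hQl]
    ext y
    have h2 : ((Q.twist l').toFun (Subgroup.inclusion inf_le_left y)).val =
        (((Q.res inf_le_left).twist l).toFun y).val := by
      rw [twist_toFun_val, hll']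
      exact (twist_toFun_val (Q.res inf_le_left) l y).symm
    exact congrArg (fun X : Matrix (Fin 1) (Fin 1) ℂ => Matrix.trace (Matrix.kronecker X
      (P'.toFun (Subgroup.inclusion inf_le_right y)).val)) h2

end GivesRel

end MainResults

end CharTriples

end

theorem mainTheorem5 {A : Type*} [Group A] [Finite A] (T S : CharTriple A) {n n' : ℕ}
    (P : ProjRep T.G n) (P' : ProjRep S.G n') (h : GivesRel T S P P') :
    ∃ σ : ∀ J : Subgroup A, (J → ℂ) → (↥(J ⊓ S.G) → ℂ),
      -- `σ_J : Char(J ∣ θ) → Char(J ∩ H ∣ φ)` is a well-defined linear map, given by the formula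
      (∀ (J : Subgroup A) (_ : T.N ≤ J) (hJG : J ≤ T.G),
        (∀ χ ∈ charOver J T.θ, ∃ (m : ℕ) (Q : ProjRep J m), Q.IsInflated T.N ∧
          Q.HasInverseFactorSet (P.res hJG) ∧ χ = Q.tensorTrace (P.res hJG)) ∧
        (∀ (m : ℕ) (Q : ProjRep J m), Q.IsInflated T.N → Q.HasInverseFactorSet (P.res hJG) →
          Q.tensorTrace (P.res hJG) ∈ charOver J T.θ ∧
          σ J (Q.tensorTrace (P.res hJG)) =
            (Q.res inf_le_left : ProjRep ↥(J ⊓ S.G) m).tensorTrace (P'.res inf_le_right)) ∧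
        Set.MapsTo (σ J) (charOver J T.θ) (charOver (J ⊓ S.G) S.θ) ∧
        ∃ L : (J → ℂ) →ₗ[ℂ] (↥(J ⊓ S.G) → ℂ), ∀ χ ∈ charOver J T.θ, σ J χ = L χ) ∧
      -- (a) restriction
      (∀ (K J : Subgroup A) (hKJ : K ≤ J), T.N ≤ K → J ≤ T.G → ∀ χ ∈ charOver J T.θ,
        res hKJ χ ∈ charOver K T.θ ∧
        res (inf_le_inf_right S.G hKJ) (σ J χ) = σ K (res hKJ χ)) ∧
      -- (b) multiplication by characters of `J / N`
      (∀ J : Subgroup A, T.N ≤ J → J ≤ T.G → ∀ χ ∈ charOver J T.θ, ∀ β ∈ charQuot T.N J,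
        χ * β ∈ charOver J T.θ ∧ σ J (χ * β) = σ J χ * res inf_le_left β) ∧
      -- (c) conjugation by elements of `H`
      (∀ J : Subgroup A, T.N ≤ J → J ≤ T.G → ∀ a ∈ S.G,
        T.N ≤ conjSub a J ∧ conjSub a J ≤ T.G ∧
        ∃ ha : conjSub a J ⊓ S.G ≤ conjSub a (J ⊓ S.G), ∀ χ ∈ charOver J T.θ,
          conjChar a le_rfl χ ∈ charOver (conjSub a J) T.θ ∧
          conjChar a ha (σ J χ) = σ (conjSub a J) (conjChar a le_rfl χ)) ∧
      -- (d) bijectivity if `J = N (J ∩ H)`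
      (∀ J : Subgroup A, T.N ≤ J → J ≤ T.G → J = T.N ⊔ (J ⊓ S.G) →
        Set.BijOn (σ J) (charOver J T.θ) (charOver (J ⊓ S.G) S.θ)) ∧
      -- strong isomorphism `(N H, N, θ) → (H, M, φ)` along the canonical map `N H / N → H / M`
      (∃ τ : (T.restrict (T.N ⊔ S.G) le_sup_left (sup_le T.N_le h.le)).Quot ≃* S.Quot,
        (∀ x : S.G, τ ((T.restrict (T.N ⊔ S.G) le_sup_left (sup_le T.N_le h.le)).proj
          (Subgroup.inclusion le_sup_right x)) = S.proj x) ∧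
        (T.restrict (T.N ⊔ S.G) le_sup_left (sup_le T.N_le h.le)).IsStrongIso S τ
          (fun J => J ⊓ S.G) σ) ∧
      -- (e) surjectivity on irreducible characters if `J / N` is abelian and `θ` extends to `J`
      (∀ (J : Subgroup A) (hNJ : T.N ≤ J), J ≤ T.G → ⁅J, J⁆ ≤ T.N →
        (∃ χ ∈ charSet J, res hNJ χ = T.θ) →
        Set.MapsTo (σ J) (irrOver J T.θ) (irrOver (J ⊓ S.G) S.θ) ∧
        Set.SurjOn (σ J) (irrOver J T.θ) (irrOver (J ⊓ S.G) S.θ)) := by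
  have := Fintype.ofFinite T.N
  refine ⟨fun J => charMap P P' J, fun J hNJ hJG => ⟨fun χ hχ =>
      h.assoc.exists_eq_tensorTrace_res hNJ hJG hχ, fun m Q hQ hQP =>
      ⟨(h.assoc.restrict hNJ hJG).tensorTrace_mem_charOver hQ hQP,
        h.charMap_tensorTrace hNJ hJG hQ⟩, h.mapsTo_charMap hNJ hJG,
      charMap P P' J, fun _ _ => rfl⟩,
    fun K J hKJ hNK hJG χ hχ => ⟨h.assoc.res_mem_charOver hKJ hNK hJG hχ,
      GivesRel.res_charMap hKJ hNK χ⟩,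
    fun J hNJ hJG χ hχ β hβ => ⟨h.assoc.mul_mem_charOver hNJ hJG hχ hβ,
      GivesRel.charMap_mul hNJ χ hβ⟩,
    fun J hNJ hJG a ha => ?_,
    fun J hNJ hJG hJ => h.bijOn_charMap hNJ hJG hJ.le, ?_,
    fun J hNJ hJG hab hext => h.charMap_irrOver hNJ hJG hab hext⟩
  -- Part (c) is the case a = γ of `conjChar_charMap`.
  · have haa : a⁻¹ * a ∈ T.N := by simp [T.N.one_mem]
    exact ⟨T.le_conjSub hNJ (h.le ha), T.conjSub_le hJG (h.le ha),
      h.conjSub_inf_le hNJ ha haa, fun χ hχ =>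
      ⟨h.assoc.conjChar_mem_charOver hNJ hJG (h.le ha) hχ,
        (h.conjChar_charMap hNJ ha haa hχ.1).symm⟩⟩
  · obtain ⟨τ, hτ⟩ := h.exists_quotEquiv
    exact ⟨τ, hτ, h.isStrongIso_charMap τ hτ⟩
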